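/- Let $K_g=\inf\{s>0: E\,e^{Z^2/s^2}\le 2\}$, $Z\sim\mathcal N(0,1)$, be the sub-Gaussian norm of a standard normal variable. Call $c>0$ admissible if $P(|\,\|\boldsymbol g\|_2-\sqrt n\,|\ge t)\le 2\exp(-ct^2/K_g^4)$ for all $n$, all $t\ge 0$ and $\boldsymbol g\sim\mathcal N_n(0,I_n)$, and put $c_1=1+K_g^2/\sqrt c$. Admissible constants exist, and there are absolute constants $C,K>0$ such that the following holds for every admissible $c$. Let $\mu\in\mathbb R^n\setminus\{0\}$ and let $\Sigma_{1},\Sigma_{-1}$ be symmetric positive definite $n\times n$ matrices. Let $X_i=\theta_i\mu+g_i^{(\theta_i)}$, $i=1,\dots,m$, be independent, where $\theta_i$ is uniform on $\{-1,1\}$ and independent of $(g_i^{(-1)},g_i^{(1)})$, and $g_i^{(j)}\sim\mathcal N_n(0,\Sigma_j)$ for $j=\pm1$. Write $\lambda_1(\cdot)$ for the largest eigenvalue and $\gamma_1(\cdot)$ for a unit eigenvector belonging to it, let $S_m=\frac1m\sum_{i=1}^m X_iX_i^\top$ and let $\Sigma=E[X_1X_1^\top]=\mu\mu^\top+(\Sigma_{-1}+\Sigma_1)/2$.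 Fix the signs by $\langle\gamma_1(\Sigma),\mu\rangle>0$ and, almost surely, $\langle\gamma_1(S_m),\gamma_1(\Sigma)\rangle>0$. Let $\lambda=\max_{j=\pm1}\lambda_1(\Sigma_j)$ and $$\delta=2^{5/2}c_1\sqrt{\frac{n\lambda}{m\|\mu\|_2^2}}+\sqrt2\,\frac{\lambda_1(\Sigma_1)+\lambda_1(\Sigma_{-1})}{\|\mu\|_2^2}\left(CK^2\left(\sqrt{\frac{2n}{m}}+\frac{2n}{m}\right)+1\right),\qquad A=\frac{\|\mu\|_2^2}{\max_{j=\pm1}\|\Sigma_j^{1/2}\mu\|_2}.$$ If $\alpha\in(0,1)$ satisfies $$\delta\le\frac{\alpha\|\mu\|_2}{c_1\sqrt{n\lambda}+\|\mu\|_2},$$ then for every $i\in\{1,\dots,m\}$ and each $j\in\{-1,1\}$ $$\Bigl|P\bigl(j\langle\gamma_1(S_m),X_i\rangle<0\,\big|\,\theta_i=j\bigr)-\Phi(-A)\Bigr|\le\alpha A\,\phi\bigl((1-\alpha)A\bigr)+10e^{-n},$$ where $\Phi$ and $\phi$ are the distribution function and the density of $\mathcal N(0,1)$. -/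

import Mathlib

open MeasureTheory ProbabilityTheory
open scoped MatrixOrder ENNReal

noncomputable section

namespace SpectralClustering

/-- The `n × n` matrix `x xᵀ`. -/
def outer {n : ℕ} (x : EuclideanSpace ℝ (Fin n)) : Matrix (Fin n) (Fin n) ℝ :=
  Matrix.vecMulVec x.ofLp x.ofLp

/-- The largest eigenvalue `λ₁(A)` of a real symmetric matrix of positive size
(the spectrum is then finite and nonempty). -/
def lambdaOne {n : ℕ} (A : Matrix (Fin n) (Fin n) ℝ) : ℝ :=
  sSup (spectrum ℝ A)

/-- `v` is a unit eigenvector of `A` for the largest eigenvalue of `A`. -/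
def IsTopEigenvector {n : ℕ} (A : Matrix (Fin n) (Fin n) ℝ)
    (v : EuclideanSpace ℝ (Fin n)) : Prop :=
  ‖v‖ = 1 ∧ Matrix.toEuclideanCLM (𝕜 := ℝ) A v = lambdaOne A • v

/-- `(θ₁, g₁), …, (θₘ, gₘ)` is a sample of the two-component Gaussian mixture: the labels `θᵢ` are
Rademacher, `gᵢ⁽ᵏ⁾ ∼ N(0, Σₖ)` for `k = ±1`, the label `θᵢ` is independent of
`(gᵢ⁽⁻¹⁾, gᵢ⁽¹⁾)`, and the `m` draws are independent. The group `ℤˣ = {1, -1}` is the set of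
labels. -/
structure IsMixtureSample {n m : ℕ} {Ω : Type*} [MeasurableSpace Ω] (P : Measure Ω)
    (S : ℤˣ → Matrix (Fin n) (Fin n) ℝ) (θ : Fin m → Ω → ℤˣ)
    (g : Fin m → ℤˣ → Ω → EuclideanSpace ℝ (Fin n)) : Prop where
  measurable_label : ∀ i, Measurable (θ i)
  rademacher : ∀ i k, P {ω | θ i ω = k} = 1 / 2
  gaussian : ∀ i k, HasLaw (g i k) (multivariateGaussian 0 (S k)) P
  indep_label_noise : ∀ i, IndepFun (θ i) (fun ω k => g i k ω) P
  indep_draws : iIndepFun (fun i ω => (θ i ω, fun k => g i k ω)) P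

/-- The observation `X = θ μ + g⁽ᶿ⁾`. -/
def observation {n : ℕ} {Ω : Type*} (μ : EuclideanSpace ℝ (Fin n)) (θ : Ω → ℤˣ)
    (g : ℤˣ → Ω → EuclideanSpace ℝ (Fin n)) (ω : Ω) : EuclideanSpace ℝ (Fin n) :=
  ((θ ω : ℤ) : ℝ) • μ + g (θ ω) ω

/-- The sample matrix `(1/m) ∑ᵢ xᵢ xᵢᵀ`. -/
def sampleMatrix {n m : ℕ} (x : Fin m → EuclideanSpace ℝ (Fin n)) : Matrix (Fin n) (Fin n) ℝ :=
  (m : ℝ)⁻¹ • ∑ i, outer (x i)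

/-- The covariance matrix `E[X Xᵀ] = μ μᵀ + (Σ₋₁ + Σ₁) / 2` of the mixture. -/
def populationMatrix {n : ℕ} (μ : EuclideanSpace ℝ (Fin n))
    (S : ℤˣ → Matrix (Fin n) (Fin n) ℝ) : Matrix (Fin n) (Fin n) ℝ :=
  outer μ + (2 : ℝ)⁻¹ • (S (-1) + S 1)

/-- `max_{k = ±1} λ₁(Σₖ)`. -/
def maxLambda {n : ℕ} (S : ℤˣ → Matrix (Fin n) (Fin n) ℝ) : ℝ :=
  max (lambdaOne (S (-1))) (lambdaOne (S 1))

/-- `‖Σ^{1/2} μ‖`, with the positive semidefinite square root. -/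
def sqrtNorm {n : ℕ} (A : Matrix (Fin n) (Fin n) ℝ) (μ : EuclideanSpace ℝ (Fin n)) : ℝ :=
  ‖Matrix.toEuclideanCLM (𝕜 := ℝ) (CFC.sqrt A) μ‖

/-- `A = ‖μ‖² / max_{k = ±1} ‖Σₖ^{1/2} μ‖`. -/
def separation {n : ℕ} (μ : EuclideanSpace ℝ (Fin n))
    (S : ℤˣ → Matrix (Fin n) (Fin n) ℝ) : ℝ :=
  ‖μ‖ ^ 2 / max (sqrtNorm (S (-1)) μ) (sqrtNorm (S 1) μ)

/-- The sub-Gaussian (Orlicz `ψ₂`) norm of a standard normal variable `Z`,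
`inf {s > 0 : E exp(Z² / s²) ≤ 2}`. -/
def psiTwoNormal : ℝ :=
  sInf {s : ℝ | 0 < s ∧ ∫⁻ z, ENNReal.ofReal (Real.exp (z ^ 2 / s ^ 2)) ∂(gaussianReal 0 1) ≤ 2}

/-- `c` is an admissible constant in the concentration inequality
`P(|‖g‖ - √n| ≥ t) ≤ 2 exp(-c t² / K_g⁴)` for standard Gaussian vectors `g` of every dimension `n`
and every `t ≥ 0`. -/
def IsNormConcentrationConstant (c : ℝ) : Prop :=
  ∀ (n : ℕ) (t : ℝ), 0 ≤ t →
    (stdGaussian (EuclideanSpace ℝ (Fin n))).real {x | t ≤ |‖x‖ - Real.sqrt n|}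
      ≤ 2 * Real.exp (-(c * t ^ 2 / psiTwoNormal ^ 4))

/-- `c₁ = 1 + K_g² / √c`. -/
def cOne (c : ℝ) : ℝ := 1 + psiTwoNormal ^ 2 / Real.sqrt c

/-- The perturbation quantity `δ`. -/
def delta {n : ℕ} (c C K : ℝ) (m : ℕ) (μ : EuclideanSpace ℝ (Fin n))
    (S : ℤˣ → Matrix (Fin n) (Fin n) ℝ) : ℝ :=
  (2 : ℝ) ^ (5 / 2 : ℝ) * cOne c * Real.sqrt (n * maxLambda S / (m * ‖μ‖ ^ 2))
    + Real.sqrt 2 * ((lambdaOne (S 1) + lambdaOne (S (-1))) / ‖μ‖ ^ 2)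
      * (C * K ^ 2 * (Real.sqrt (2 * n / m) + 2 * n / m) + 1)

end SpectralClustering

end

/-! Write u = μ/‖μ‖ and L = λ₁(Σ₁) + λ₁(Σ₋₁). The estimate is two-sided only in appearance. The
hypothesis forces L/‖μ‖² ≤ δ ≤ α, while A² ≥ ‖μ‖²/L (`sq_separation_ge`), so αA² ≥ 1. By the Mills
bound, Φ(-A) ≤ φ(A)/A is then already below the error term, and the lower estimate holds for any p ≥
0 (`abs_sub_cdf_le`). What remains is the upper bound p ≤ Φ(-(1-α)A) + 10e⁻ⁿ
(`IsMixtureSample.cond_misclassified_le`).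

This bound needs no independence of γ₁(Sₘ) and Xᵢ. Outside an event of probability O(e⁻ⁿ), ‖γ₁(Sₘ) -
u‖ ≤ δ and the noise g in Xᵢ has norm at most c₁√(nλ). Replacing γ₁(Sₘ) by u then changes the inner
product by at most δ(c₁√(nλ) + ‖μ‖) ≤ α‖μ‖, so a misclassification forces ⟨μ, jg⟩ < -(1-α)‖μ‖². This
is a one-dimensional Gaussian event of probability at most Φ(-(1-α)A).

For the closeness of γ₁(Sₘ) and u, Sₘ - μμᵀ splits into cross terms governed by the mean of θᵢgᵢ and
the second-moment matrix of the noise. The sum of the θᵢgᵢ is a mixture of centred Gaussians, so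
admissibility of c bounds its norm (`conv_sum_tail`). The noise matrix is controlled by integrating
exponential moments over a ball, which replaces an ε-net (`centredForm_deviation`). A rank-one
Davis–Kahan bound (`one_sub_inner_sq_le`) turns both into an angle, and the sign is carried over
through γ₁(Σ), which is close to u for the same reason (`inner_nonneg_of_inner_pos`). The constants
are C = 168 and K = 1. -/

namespace SpectralClustering

/-! ### Exponential moments of Z² and the existence of an admissible constant -/

/-- The moment generating function of the square of a standard normal variable. -/
theorem lintegral_exp_mul_sq_gaussianReal {s : ℝ} (hs : s < 1 / 2) :
    ∫⁻ z, ENNReal.ofReal (Real.exp (s * z ^ 2)) ∂(gaussianReal 0 1)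
      = ENNReal.ofReal (Real.sqrt (1 - 2 * s))⁻¹ := by
  have hb : 0 < 1 / 2 - s := by linarith
  have hpdf : ∀ z : ℝ, gaussianPDF 0 1 z * ENNReal.ofReal (Real.exp (s * z ^ 2))
      = ENNReal.ofReal ((Real.sqrt (2 * Real.pi))⁻¹ * Real.exp (-(1 / 2 - s) * z ^ 2)) := by
    intro z
    rw [gaussianPDF_def, ← ENNReal.ofReal_mul (gaussianPDFReal_nonneg _ _ _), gaussianPDFReal_def]
    simp only [NNReal.coe_one, mul_one, sub_zero]
    rw [mul_assoc, ← Real.exp_add]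
    congr 3
    ring
  rw [gaussianReal_of_var_ne_zero 0 one_ne_zero,
    lintegral_withDensity_eq_lintegral_mul _ (measurable_gaussianPDF 0 1) (by fun_prop)]
  simp only [Pi.mul_apply, hpdf]
  rw [← ofReal_integral_eq_lintegral_ofReal
    ((integrable_exp_neg_mul_sq hb).const_mul _) (ae_of_all _ fun z => by positivity),
    integral_const_mul, integral_gaussian, ← Real.sqrt_inv, ← Real.sqrt_inv,
    ← Real.sqrt_mul (by positivity)]
  congr 2
  have h1 : (1 - 2 * s) ≠ 0 := by linarith
  have h2 : (1 / 2 - s) ≠ 0 := hb.ne'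
  have h3 := Real.pi_ne_zero
  have h4 : (1 - 2 * s) = 2 * (1 / 2 - s) := by ring
  rw [h4]
  field_simp

theorem inv_sqrt_one_sub_le {u : ℝ} (h₁ : -(1 / 2) ≤ u) (h₂ : u ≤ 1 / 2) :
    (Real.sqrt (1 - u))⁻¹ ≤ 1 + u / 2 + u ^ 2 := by
  have h0 : 0 < 1 + u / 2 + u ^ 2 := by nlinarith [sq_nonneg u]
  rw [inv_le_comm₀ (Real.sqrt_pos.2 (by linarith)) h0]
  apply Real.le_sqrt_of_sq_le
  rw [inv_pow, inv_le_iff_one_le_mul₀ (by positivity)]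
  have h5 : (1 - u) * (1 + u / 2 + u ^ 2) ^ 2 - 1
      = u ^ 2 * (5 / 4 - 5 / 4 * u - u ^ 3) := by ring
  have h6 : u ^ 3 ≤ 1 / 8 := by nlinarith [sq_nonneg u, sq_nonneg (u + 1/2), sq_nonneg (u+1)]
  nlinarith [mul_nonneg (sq_nonneg u) (by linarith : 0 ≤ 5 / 4 - 5 / 4 * u - u ^ 3)]

theorem lintegral_exp_mul_sq_gaussianReal_le {s : ℝ} (h₁ : -(1 / 4) ≤ s) (h₂ : s ≤ 1 / 4) :
    ∫⁻ z, ENNReal.ofReal (Real.exp (s * z ^ 2)) ∂(gaussianReal 0 1)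
      ≤ ENNReal.ofReal (1 + s + 4 * s ^ 2) := by
  rw [lintegral_exp_mul_sq_gaussianReal (by linarith)]
  apply ENNReal.ofReal_le_ofReal
  have := inv_sqrt_one_sub_le (u := 2 * s) (by linarith) (by linarith)
  linarith

/-- Two facts are needed, because the infimum of an empty set is 0: some s is feasible, and no s < 1
is. For s < 1 the expectation is at least its value 4 at the exponent 15/32. -/
theorem psiTwoNormal_pos : 0 < psiTwoNormal := by
  have h4 : Real.sqrt 4 = 2 := by
    rw [show (4 : ℝ) = 2 ^ 2 by norm_num]; exact Real.sqrt_sq (by norm_num)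
  have hmem : (2 : ℝ) ∈ {s : ℝ | 0 < s ∧
      ∫⁻ z, ENNReal.ofReal (Real.exp (z ^ 2 / s ^ 2)) ∂(gaussianReal 0 1) ≤ 2} := by
    refine ⟨by norm_num, ?_⟩
    have h := lintegral_exp_mul_sq_gaussianReal_le (s := 1 / 4) (by norm_num) le_rfl
    calc _ = _ := lintegral_congr fun z => by congr 2; ring
      _ ≤ _ := h
      _ ≤ ENNReal.ofReal 2 := ENNReal.ofReal_le_ofReal (by norm_num)
      _ = 2 := by simp
  have hlow : ∀ s ∈ {s : ℝ | 0 < s ∧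
      ∫⁻ z, ENNReal.ofReal (Real.exp (z ^ 2 / s ^ 2)) ∂(gaussianReal 0 1) ≤ 2}, 1 ≤ s := by
    rintro s ⟨hs, hle⟩
    by_contra! hlt
    have h := lintegral_exp_mul_sq_gaussianReal (s := 15 / 32) (by norm_num)
    have hval : (Real.sqrt (1 - 2 * (15 / 32)))⁻¹ = 4 := by
      rw [← Real.sqrt_inv, show (1 - 2 * (15 / 32 : ℝ))⁻¹ = 4 ^ 2 by norm_num]
      exact Real.sqrt_sq (by norm_num)
    have : ENNReal.ofReal 4 ≤ ENNReal.ofReal 2 := by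
      rw [← hval, ← h]
      refine (lintegral_mono fun z => ?_).trans (hle.trans (by simp))
      apply ENNReal.ofReal_le_ofReal
      apply Real.exp_le_exp.2
      rw [le_div_iff₀ (by positivity)]
      have : s ^ 2 ≤ 1 := by nlinarith
      nlinarith [sq_nonneg z, mul_nonneg (sq_nonneg z) (sub_nonneg.2 this)]
    rw [ENNReal.ofReal_le_ofReal_iff (by norm_num)] at this
    norm_num at this
  exact lt_of_lt_of_le one_pos (le_csInf ⟨2, hmem⟩ hlow)

theorem lintegral_exp_mul_norm_sq_stdGaussian_le (n : ℕ) {s : ℝ}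
    (h₁ : -(1 / 4) ≤ s) (h₂ : s ≤ 1 / 4) :
    ∫⁻ x, ENNReal.ofReal (Real.exp (s * ‖x‖ ^ 2)) ∂(stdGaussian (EuclideanSpace ℝ (Fin n)))
      ≤ ENNReal.ofReal (Real.exp (n * (s + 4 * s ^ 2))) := by
  rw [← map_pi_eq_stdGaussian, lintegral_map (by fun_prop) (by fun_prop)]
  have hprod : ∀ x : Fin n → ℝ, ENNReal.ofReal (Real.exp (s * ‖WithLp.toLp 2 x‖ ^ 2))
      = ∏ i, ENNReal.ofReal (Real.exp (s * x i ^ 2)) := by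
    intro x
    rw [← ENNReal.ofReal_prod_of_nonneg fun i _ => (Real.exp_pos _).le, ← Real.exp_sum,
      ← Finset.mul_sum, EuclideanSpace.real_norm_sq_eq]
  simp only [hprod]
  have hind := iIndepFun_pi (μ := fun _ : Fin n => gaussianReal 0 1)
    (X := fun _ z => ENNReal.ofReal (Real.exp (s * z ^ 2))) (fun i => by fun_prop)
  rw [lintegral_prod_eq_prod_lintegral_of_indepFun _ _ hind (fun i => by fun_prop)]
  have hone : ∀ i : Fin n, ∫⁻ x : Fin n → ℝ, ENNReal.ofReal (Real.exp (s * x i ^ 2))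
      ∂(Measure.pi fun _ => gaussianReal 0 1) ≤ ENNReal.ofReal (Real.exp (s + 4 * s ^ 2)) := by
    intro i
    have := (measurePreserving_eval (fun _ : Fin n => gaussianReal 0 1) i).lintegral_comp
      (f := fun z => ENNReal.ofReal (Real.exp (s * z ^ 2))) (by fun_prop)
    simp only [Function.eval] at this
    rw [this]
    refine (lintegral_exp_mul_sq_gaussianReal_le h₁ h₂).trans (ENNReal.ofReal_le_ofReal ?_)
    have := Real.add_one_le_exp (s + 4 * s ^ 2)
    linarith
  refine (Finset.prod_le_prod' fun i _ => hone i).trans ?_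
  rw [Finset.prod_const, Finset.card_univ, Fintype.card_fin, ← ENNReal.ofReal_pow (by positivity),
    ← Real.exp_nat_mul]

theorem measureReal_le_of_lintegral_exp_le {Ω : Type*} [MeasurableSpace Ω] {P : Measure Ω}
    [IsFiniteMeasure P] {f : Ω → ℝ} (hf : AEMeasurable f P) {a b : ℝ}
    (h : ∫⁻ ω, ENNReal.ofReal (Real.exp (f ω)) ∂P ≤ ENNReal.ofReal (Real.exp a)) :
    P.real {ω | b ≤ f ω} ≤ Real.exp (a - b) := by
  have hmk := mul_meas_ge_le_lintegral₀ (μ := P)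
    (f := fun ω => ENNReal.ofReal (Real.exp (f ω))) (by fun_prop) (ENNReal.ofReal (Real.exp b))
  have hset : {ω | ENNReal.ofReal (Real.exp b) ≤ ENNReal.ofReal (Real.exp (f ω))}
      = {ω | b ≤ f ω} := by
    ext ω
    simp [ENNReal.ofReal_le_ofReal_iff (Real.exp_pos _).le]
  rw [hset] at hmk
  have h2 := ENNReal.toReal_mono (by simp) (hmk.trans h)
  rw [ENNReal.toReal_mul, ENNReal.toReal_ofReal (Real.exp_pos _).le,
    ENNReal.toReal_ofReal (Real.exp_pos _).le] at h2
  rw [Real.exp_sub, le_div_iff₀ (Real.exp_pos _), mul_comm]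
  exact h2

/-- Chernoff's bound for ‖x‖² with exponent of order t/√n. For t > √n the upper tail uses the cap s
= 1/4 of the moment bound, and the lower event is empty. -/
theorem stdGaussian_norm_sub_sqrt_tail (n : ℕ) {t : ℝ} (ht : 0 ≤ t) :
    (stdGaussian (EuclideanSpace ℝ (Fin n))).real {x | t ≤ |‖x‖ - Real.sqrt n|}
      ≤ 2 * Real.exp (-(t ^ 2 / 16)) := by
  set γ := stdGaussian (EuclideanSpace ℝ (Fin n))
  set r := Real.sqrt n
  have hr : 0 ≤ r := Real.sqrt_nonneg _
  have hr2 : r ^ 2 = n := Real.sq_sqrt (Nat.cast_nonneg n)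
  have key : ∀ s b : ℝ, -(1 / 4) ≤ s → s ≤ 1 / 4 →
      γ.real {x | b ≤ s * ‖x‖ ^ 2} ≤ Real.exp (n * (s + 4 * s ^ 2) - b) := fun s b h₁ h₂ =>
    measureReal_le_of_lintegral_exp_le (by fun_prop)
      (lintegral_exp_mul_norm_sq_stdGaussian_le n h₁ h₂)
  have hupper : γ.real {x | r + t ≤ ‖x‖} ≤ Real.exp (-(t ^ 2 / 16)) := by
    have hstep : ∀ s : ℝ, 0 ≤ s → s ≤ 1 / 4 →
        r ^ 2 * (s + 4 * s ^ 2) - s * (r + t) ^ 2 ≤ -(t ^ 2 / 16) →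
        γ.real {x | r + t ≤ ‖x‖} ≤ Real.exp (-(t ^ 2 / 16)) := by
      intro s h0 h1 h2
      refine (measureReal_mono ?_).trans
        ((key s (s * (r + t) ^ 2) (by linarith) h1).trans (Real.exp_le_exp.2 (by rwa [← hr2])))
      intro x hx
      have hx' : r + t ≤ ‖x‖ := hx
      exact mul_le_mul_of_nonneg_left (by gcongr) h0
    rcases lt_or_ge r t with h | h
    · exact hstep (1 / 4) (by norm_num) le_rfl (by nlinarith)
    · rcases hr.eq_or_lt with h0 | h0
      · exact hstep (1 / 4) (by norm_num) le_rfl (by nlinarith)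
      · refine hstep (t / (4 * r)) (by positivity) ?_ ?_
        · rw [div_le_iff₀ (by positivity)]; linarith
        · have e : r ^ 2 * (t / (4 * r) + 4 * (t / (4 * r)) ^ 2) - t / (4 * r) * (r + t) ^ 2
              = -(t ^ 2 / 4) - t ^ 3 / (4 * r) := by field_simp; ring
          rw [e]
          have : 0 ≤ t ^ 3 / (4 * r) := by positivity
          nlinarith [sq_nonneg t]
  have hlower : γ.real {x | ‖x‖ ≤ r - t} ≤ Real.exp (-(t ^ 2 / 16)) := by
    rcases lt_or_ge r t with h | h
    · have : {x : EuclideanSpace ℝ (Fin n) | ‖x‖ ≤ r - t} = ∅ := by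
        ext x
        simp only [Set.mem_ofPred_eq, Set.mem_empty_iff_false, iff_false, not_le]
        linarith [norm_nonneg x]
      rw [this]
      simp [(Real.exp_pos _).le]
    · rcases ht.eq_or_lt with h0 | h0
      · rw [← h0]
        simp
      have hr0 : 0 < r := by linarith
      have hs : t / (8 * r) ≤ 1 / 4 := by
        rw [div_le_iff₀ (by positivity)]; linarith
      have hs0 : 0 ≤ t / (8 * r) := by positivity
      refine (measureReal_mono ?_).trans
        ((key (-(t / (8 * r))) (-(t / (8 * r)) * (r - t) ^ 2) (by linarith) (by linarith)).trans
          (Real.exp_le_exp.2 ?_))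
      · intro x hx
        have hx' : ‖x‖ ≤ r - t := hx
        exact mul_le_mul_of_nonpos_left (pow_le_pow_left₀ (norm_nonneg x) hx' 2) (by linarith)
      · rw [← hr2]
        have e : r ^ 2 * (-(t / (8 * r)) + 4 * (-(t / (8 * r))) ^ 2)
            - -(t / (8 * r)) * (r - t) ^ 2 = -(t ^ 2 * (3 / 16)) + t ^ 2 * (t / (8 * r)) := by
          field_simp; ring
        rw [e]
        have hs' : t / (8 * r) ≤ 1 / 8 := by
          rw [div_le_iff₀ (by positivity)]; linarith
        nlinarith [mul_le_mul_of_nonneg_left hs' (sq_nonneg t)]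
  calc γ.real {x | t ≤ |‖x‖ - r|} ≤ γ.real ({x | r + t ≤ ‖x‖} ∪ {x | ‖x‖ ≤ r - t}) := by
        refine measureReal_mono fun x hx => ?_
        rcases le_abs.1 (Set.mem_ofPred_eq ▸ hx) with h | h
        · left; simp only [Set.mem_ofPred_eq]; linarith
        · right; simp only [Set.mem_ofPred_eq]; linarith
    _ ≤ _ := measureReal_union_le _ _
    _ ≤ _ := by linarith

theorem exists_isNormConcentrationConstant : ∃ c : ℝ, 0 < c ∧ IsNormConcentrationConstant c := by
  have hK := psiTwoNormal_pos
  -- The factor K_g⁴ cancels the one built into the definition of admissibility.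
  refine ⟨psiTwoNormal ^ 4 / 16, by positivity, fun n t ht => ?_⟩
  have e : psiTwoNormal ^ 4 / 16 * t ^ 2 / psiTwoNormal ^ 4 = t ^ 2 / 16 := by field_simp
  rw [e]
  exact stdGaussian_norm_sub_sqrt_tail n ht

/-! ### Quadratic forms of symmetric matrices and the largest eigenvalue -/

section Forms

variable {n : ℕ} {A : Matrix (Fin n) (Fin n) ℝ}

theorem isHermitian_outer (x : EuclideanSpace ℝ (Fin n)) : (outer x).IsHermitian := by
  ext i j
  simp [outer, Matrix.vecMulVec_apply, mul_comm]

theorem inner_toEuclideanCLM_outer (x y z : EuclideanSpace ℝ (Fin n)) :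
    inner ℝ x (Matrix.toEuclideanCLM (𝕜 := ℝ) (outer y) z) = inner ℝ x y * inner ℝ y z := by
  rw [Matrix.inner_toEuclideanCLM, outer, Matrix.vecMulVec_mulVec]
  simp [EuclideanSpace.inner_eq_star_dotProduct, dotProduct_comm, mul_comm]

theorem inner_toEuclideanCLM_le_lambdaOne (hA : A.IsHermitian) (x : EuclideanSpace ℝ (Fin n)) :
    inner ℝ x (Matrix.toEuclideanCLM (𝕜 := ℝ) A x) ≤ lambdaOne A * ‖x‖ ^ 2 := by
  have hbdd : BddAbove (spectrum ℝ A) := (Matrix.finite_spectrum A).bddAbove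
  have hle : A ≤ algebraMap ℝ (Matrix (Fin n) (Fin n) ℝ) (lambdaOne A) :=
    le_algebraMap_of_spectrum_le (fun r hr => le_csSup hbdd hr) hA.isSelfAdjoint
  have h := (Matrix.le_iff.1 hle).dotProduct_mulVec_nonneg x.ofLp
  rw [Matrix.sub_mulVec, dotProduct_sub, Algebra.algebraMap_eq_smul_one, Matrix.smul_mulVec,
    Matrix.one_mulVec, dotProduct_smul, sub_nonneg] at h
  rw [Matrix.inner_toEuclideanCLM, EuclideanSpace.real_norm_sq_eq]
  simpa [dotProduct, sq] using h

theorem IsTopEigenvector.inner_le_inner {v : EuclideanSpace ℝ (Fin n)} (hv : IsTopEigenvector A v)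
    (hA : A.IsHermitian) {u : EuclideanSpace ℝ (Fin n)} (hu : ‖u‖ = 1) :
    inner ℝ u (Matrix.toEuclideanCLM (𝕜 := ℝ) A u)
      ≤ inner ℝ v (Matrix.toEuclideanCLM (𝕜 := ℝ) A v) := by
  rw [hv.2, real_inner_smul_right, real_inner_self_eq_norm_sq, hv.1]
  simpa [hu] using inner_toEuclideanCLM_le_lambdaOne hA u

theorem inner_sqrt_sqrt (hA : A.PosSemidef) (x y : EuclideanSpace ℝ (Fin n)) :
    inner ℝ (Matrix.toEuclideanCLM (𝕜 := ℝ) (CFC.sqrt A) x)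
      (Matrix.toEuclideanCLM (𝕜 := ℝ) (CFC.sqrt A) y)
      = inner ℝ x (Matrix.toEuclideanCLM (𝕜 := ℝ) A y) := by
  have hsa : IsSelfAdjoint (Matrix.toEuclideanCLM (𝕜 := ℝ) (CFC.sqrt A)) :=
    (CFC.sqrt_nonneg A).isSelfAdjoint.map _
  rw [← ContinuousLinearMap.adjoint_inner_right, hsa.adjoint_eq,
    ← ContinuousLinearMap.comp_apply, ← ContinuousLinearMap.mul_def, ← map_mul,
    CFC.sqrt_mul_sqrt_self _ hA.nonneg]

theorem sqrtNorm_sq (hA : A.PosSemidef) (x : EuclideanSpace ℝ (Fin n)) :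
    sqrtNorm A x ^ 2 = inner ℝ x (Matrix.toEuclideanCLM (𝕜 := ℝ) A x) := by
  rw [sqrtNorm, ← real_inner_self_eq_norm_sq, inner_sqrt_sqrt hA]

theorem inner_toEuclideanCLM_pos (hA : A.PosDef) {x : EuclideanSpace ℝ (Fin n)} (hx : x ≠ 0) :
    0 < inner ℝ x (Matrix.toEuclideanCLM (𝕜 := ℝ) A x) := by
  rw [Matrix.inner_toEuclideanCLM]
  exact hA.dotProduct_mulVec_pos (x := x.ofLp) (by simpa using hx)

theorem lambdaOne_pos (hA : A.PosDef) {x : EuclideanSpace ℝ (Fin n)} (hx : x ≠ 0) :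
    0 < lambdaOne A := by
  have h := (inner_toEuclideanCLM_pos hA hx).trans_le
    (inner_toEuclideanCLM_le_lambdaOne hA.isHermitian x)
  exact pos_of_mul_pos_left h (sq_nonneg _)

theorem sqrtNorm_le_of_forall {a : ℝ} (hA : A.PosSemidef)
    (ha : ∀ x, inner ℝ x (Matrix.toEuclideanCLM (𝕜 := ℝ) A x) ≤ a * ‖x‖ ^ 2)
    (x : EuclideanSpace ℝ (Fin n)) : sqrtNorm A x ≤ Real.sqrt a * ‖x‖ := by
  rw [← Real.sqrt_sq (norm_nonneg x), ← Real.sqrt_mul' _ (sq_nonneg _)]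
  apply Real.le_sqrt_of_sq_le
  rw [sqrtNorm_sq hA]
  exact ha x

theorem sqrtNorm_le (hA : A.PosSemidef) (x : EuclideanSpace ℝ (Fin n)) :
    sqrtNorm A x ≤ Real.sqrt (lambdaOne A) * ‖x‖ :=
  sqrtNorm_le_of_forall hA (inner_toEuclideanCLM_le_lambdaOne hA.isHermitian) x

theorem inner_toEuclideanCLM_le_mul_norm (hA : A.PosSemidef) (h0 : 0 ≤ lambdaOne A)
    (x y : EuclideanSpace ℝ (Fin n)) :
    inner ℝ x (Matrix.toEuclideanCLM (𝕜 := ℝ) A y) ≤ lambdaOne A * (‖x‖ * ‖y‖) := by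
  rw [← inner_sqrt_sqrt hA]
  refine (real_inner_le_norm _ _).trans ?_
  have h := mul_le_mul (sqrtNorm_le hA x) (sqrtNorm_le hA y) (norm_nonneg _) (by positivity)
  refine h.trans_eq ?_
  rw [mul_mul_mul_comm, Real.mul_self_sqrt h0]

theorem isHermitian_sampleMatrix {m : ℕ} (x : Fin m → EuclideanSpace ℝ (Fin n)) :
    (sampleMatrix x).IsHermitian := by
  have h : (∑ i, outer (x i)).IsHermitian := by
    rw [Matrix.IsHermitian, Matrix.conjTranspose_sum]
    exact Finset.sum_congr rfl fun i _ => isHermitian_outer (x i)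
  rw [Matrix.IsHermitian, sampleMatrix, Matrix.conjTranspose_smul, h.eq, star_trivial]

theorem inner_toEuclideanCLM_sampleMatrix {m : ℕ} (x : Fin m → EuclideanSpace ℝ (Fin n))
    (y z : EuclideanSpace ℝ (Fin n)) :
    inner ℝ y (Matrix.toEuclideanCLM (𝕜 := ℝ) (sampleMatrix x) z)
      = (m : ℝ)⁻¹ * ∑ i, inner ℝ y (x i) * inner ℝ (x i) z := by
  rw [sampleMatrix, map_smul, map_sum, smul_apply,
    sum_apply, real_inner_smul_right, inner_sum]
  simp only [inner_toEuclideanCLM_outer]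

theorem isHermitian_populationMatrix (μ : EuclideanSpace ℝ (Fin n))
    {S : ℤˣ → Matrix (Fin n) (Fin n) ℝ} (hS : ∀ k, (S k).IsHermitian) :
    (populationMatrix μ S).IsHermitian := by
  refine (isHermitian_outer μ).add ?_
  rw [Matrix.IsHermitian, Matrix.conjTranspose_smul, ((hS (-1)).add (hS 1)).eq, star_trivial]

theorem inner_toEuclideanCLM_populationMatrix (μ : EuclideanSpace ℝ (Fin n))
    (S : ℤˣ → Matrix (Fin n) (Fin n) ℝ) (x y : EuclideanSpace ℝ (Fin n)) :
    inner ℝ x (Matrix.toEuclideanCLM (𝕜 := ℝ) (populationMatrix μ S) y)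
      = inner ℝ x μ * inner ℝ μ y
        + 2⁻¹ * (inner ℝ x (Matrix.toEuclideanCLM (𝕜 := ℝ) (S (-1)) y)
          + inner ℝ x (Matrix.toEuclideanCLM (𝕜 := ℝ) (S 1) y)) := by
  rw [populationMatrix, map_add, map_smul, map_add, add_apply,
    smul_apply, add_apply, inner_add_right,
    real_inner_smul_right, inner_add_right, inner_toEuclideanCLM_outer]

end Forms

/-! ### Perturbation of the top eigenvector of a rank-one matrix -/

section Perturbation

variable {E : Type*} [NormedAddCommGroup E] [InnerProductSpace ℝ E]

/-- A variant of the Davis–Kahan theorem for a rank-one matrix `μ μᵀ` perturbed by `M - μ μᵀ`. -/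
theorem one_sub_inner_sq_le {M : E →L[ℝ] E} {u v μ : E} {B : ℝ} (hM : (M : E →ₗ[ℝ] E).IsSymmetric)
    (hu : ‖u‖ = 1) (hv : ‖v‖ = 1) (hμ : μ ≠ 0) (huμ : μ = ‖μ‖ • u)
    (hmax : inner ℝ u (M u) ≤ inner ℝ v (M v)) (hB : 0 ≤ B)
    (hbd : ∀ x y, inner ℝ x (M y) - inner ℝ x μ * inner ℝ μ y ≤ B * (‖x‖ * ‖y‖)) :
    1 - inner ℝ v u ^ 2 ≤ (2 * B / ‖μ‖ ^ 2) ^ 2 := by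
  have hκ : 0 < ‖μ‖ ^ 2 := by positivity
  set a := inner ℝ v u with ha
  have habs : a ^ 2 ≤ 1 := by
    have := abs_real_inner_le_norm v u
    rw [hu, hv, ← ha, mul_one] at this
    exact (sq_le_one_iff_abs_le_one a).2 this
  have hsub : ‖v - u‖ ^ 2 = 2 - 2 * a := by
    rw [norm_sub_sq_real, hu, hv, ← ha]; ring
  have hadd : ‖v + u‖ ^ 2 = 2 + 2 * a := by
    rw [norm_add_sq_real, hu, hv, ← ha]; ring
  have hprod : ‖v - u‖ * ‖v + u‖ = 2 * Real.sqrt (1 - a ^ 2) := by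
    rw [← Real.sqrt_sq (by positivity : 0 ≤ ‖v - u‖ * ‖v + u‖), mul_pow, hsub, hadd,
      show (2 - 2 * a) * (2 + 2 * a) = 2 ^ 2 * (1 - a ^ 2) by ring,
      Real.sqrt_mul (by norm_num), Real.sqrt_sq (by norm_num)]
  -- By symmetry ⟨v-u, M(v+u)⟩ = ⟨v, Mv⟩ - ⟨u, Mu⟩ ≥ 0, while ⟨v-u, μ⟩⟨μ, v+u⟩ = -‖μ‖²(1-a²). As
  -- ‖v-u‖‖v+u‖ = 2√(1-a²), one factor √(1-a²) cancels.
  have h := hbd (v - u) (v + u)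
  have hsym : inner ℝ v (M u) = inner ℝ u (M v) := by
    rw [real_inner_comm]; exact hM u v
  have h1 : inner ℝ v μ = ‖μ‖ * a := by
    conv_lhs => rw [huμ]
    rw [real_inner_smul_right]
  have h2 : inner ℝ u μ = ‖μ‖ := by
    conv_lhs => rw [huμ]
    rw [real_inner_smul_right, real_inner_self_eq_norm_sq, hu]; ring
  rw [hprod, map_add, inner_sub_left, inner_sub_left, inner_add_right, inner_add_right,
    inner_add_right, real_inner_comm v μ, real_inner_comm u μ, h1, h2, hsym] at h
  set s := Real.sqrt (1 - a ^ 2)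
  have hs : s ^ 2 = 1 - a ^ 2 := Real.sq_sqrt (by linarith)
  have hs0 : 0 ≤ s := Real.sqrt_nonneg _
  have h3 : ‖μ‖ ^ 2 * s ^ 2 ≤ 2 * B * s := by rw [hs]; nlinarith
  have h4 : s ≤ 2 * B / ‖μ‖ ^ 2 := by
    rw [le_div_iff₀ hκ]
    rcases hs0.eq_or_lt with h0 | h0
    · rw [← h0]; linarith
    · nlinarith
  rw [← hs]
  exact pow_le_pow_left₀ hs0 h4 2

/-- Both v and w lie within 45° of the line through u. Were they on opposite sides, their components
along u would contribute less than -1/2 to ⟨v, w⟩ and the orthogonal ones less than 1/2, against ⟨v,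
w⟩ > 0. -/
theorem inner_nonneg_of_inner_pos {u v w : E} (hu : ‖u‖ = 1) (hv : ‖v‖ = 1) (hw : ‖w‖ = 1)
    (hvw : 0 < inner ℝ v w) (hwu : 0 < inner ℝ w u) (h₁ : 1 / 2 < inner ℝ v u ^ 2)
    (h₂ : 1 / 2 < inner ℝ w u ^ 2) : 0 ≤ inner ℝ v u := by
  by_contra! hneg
  set a := inner ℝ v u with ha
  set b := inner ℝ w u with hb
  have huu : inner ℝ u u = 1 := by rw [real_inner_self_eq_norm_sq, hu]; norm_num
  have h3 : inner ℝ (v - a • u) (w - b • u) = inner ℝ v w - a * b := by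
    simp only [inner_sub_left, inner_sub_right, real_inner_smul_left, real_inner_smul_right,
      huu, real_inner_comm w u, ← ha, ← hb]
    ring
  have hn : ∀ x : E, ‖x‖ = 1 → 1 / 2 < inner ℝ x u ^ 2 →
      ‖x - inner ℝ x u • u‖ ^ 2 < 1 / 2 := by
    intro x hx hxu
    rw [norm_sub_sq_real, norm_smul, hu, hx, real_inner_smul_right, mul_one, Real.norm_eq_abs,
      sq_abs]
    nlinarith
  have h4 := hn v hv h₁
  have h5 := hn w hw h₂
  have h6 := real_inner_le_norm (v - a • u) (w - b • u)
  rw [h3] at h6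
  have h7 : ‖v - a • u‖ * ‖w - b • u‖ < 1 / 2 := by
    nlinarith [sq_nonneg (‖v - a • u‖ - ‖w - b • u‖)]
  have h8 : 1 / 2 < -(a * b) := by
    have : 1 / 4 < (-(a * b)) ^ 2 := by nlinarith
    have h9 : 0 < -(a * b) := by nlinarith
    nlinarith
  linarith

theorem norm_sub_le_of_inner_nonneg {u v : E} (hu : ‖u‖ = 1) (hv : ‖v‖ = 1)
    (h0 : 0 ≤ inner ℝ v u) {ε : ℝ} (hε : 0 ≤ ε) (h : 1 - inner ℝ v u ^ 2 ≤ ε ^ 2) :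
    ‖v - u‖ ≤ Real.sqrt 2 * ε := by
  apply le_of_sq_le_sq _ (by positivity)
  rw [norm_sub_sq_real, hu, hv, mul_pow, Real.sq_sqrt (by norm_num)]
  have h1 : inner ℝ v u ≤ 1 := by
    have := real_inner_le_norm v u
    rwa [hu, hv, mul_one] at this
  nlinarith

end Perturbation

/-! ### Marginals, convolutions and norm tails of Gaussian vectors -/

section MultivariateGaussian

variable {n : ℕ} {T : Matrix (Fin n) (Fin n) ℝ}

theorem map_inner_multivariateGaussian (hT : T.PosSemidef) (x : EuclideanSpace ℝ (Fin n)) :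
    (multivariateGaussian 0 T).map (fun y => inner ℝ x y)
      = (gaussianReal 0 1).map (fun z => sqrtNorm T x * z) := by
  have h := IsGaussian.map_eq_gaussianReal (μ := multivariateGaussian 0 T) (innerSL ℝ x)
  have hmean : (multivariateGaussian 0 T)[innerSL ℝ x] = 0 := by
    rw [ContinuousLinearMap.integral_comp_id_comm IsGaussian.integrable_id,
      integral_id_multivariateGaussian, map_zero]
  have hvar : Var[innerSL ℝ x; multivariateGaussian 0 T] = sqrtNorm T x ^ 2 := by
    rw [sqrtNorm_sq hT, Matrix.inner_toEuclideanCLM, ← covarianceBilin_multivariateGaussian hT,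
      covarianceBilin_self IsGaussian.memLp_two_id]
    rfl
  rw [hmean, hvar] at h
  rw [gaussianReal_map_const_mul, mul_zero, mul_one]
  refine Eq.trans h ?_
  congr 1
  ext
  simp [sq_nonneg]

theorem lintegral_exp_mul_inner_sq_le (hT : T.PosSemidef) (x : EuclideanSpace ℝ (Fin n)) {s : ℝ}
    (h₁ : -(1 / 4) ≤ s * sqrtNorm T x ^ 2) (h₂ : s * sqrtNorm T x ^ 2 ≤ 1 / 4) :
    ∫⁻ y, ENNReal.ofReal (Real.exp (s * inner ℝ x y ^ 2)) ∂(multivariateGaussian 0 T)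
      ≤ ENNReal.ofReal (1 + s * sqrtNorm T x ^ 2 + 4 * (s * sqrtNorm T x ^ 2) ^ 2) := by
  have h := lintegral_map (μ := multivariateGaussian 0 T) (g := fun y => inner ℝ x y)
    (f := fun z => ENNReal.ofReal (Real.exp (s * z ^ 2))) (by fun_prop) (by fun_prop)
  rw [← h, map_inner_multivariateGaussian hT, lintegral_map (by fun_prop) (by fun_prop)]
  have e : ∀ z : ℝ, s * (sqrtNorm T x * z) ^ 2 = (s * sqrtNorm T x ^ 2) * z ^ 2 := fun z => by ring
  simp only [e]
  exact lintegral_exp_mul_sq_gaussianReal_le h₁ h₂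

theorem multivariateGaussian_inner_lt (hT : T.PosSemidef) {x : EuclideanSpace ℝ (Fin n)}
    (hx : 0 < sqrtNorm T x) (b : ℝ) :
    (multivariateGaussian 0 T).real {y | inner ℝ x y < -b}
      ≤ cdf (gaussianReal 0 1) (-(b / sqrtNorm T x)) := by
  have h : (multivariateGaussian 0 T).real {y | inner ℝ x y < -b}
      = ((multivariateGaussian 0 T).map (fun y => inner ℝ x y)).real (Set.Iio (-b)) := by
    rw [map_measureReal_apply (by fun_prop) measurableSet_Iio]
    rfl
  rw [h, map_inner_multivariateGaussian hT, map_measureReal_apply (by fun_prop) measurableSet_Iio,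
    cdf_eq_real]
  refine measureReal_mono fun z hz => ?_
  have hz' : sqrtNorm T x * z < -b := hz
  simp only [Set.mem_Iic]
  rw [← neg_div, le_div_iff₀ hx]
  linarith

theorem multivariateGaussian_neg (T : Matrix (Fin n) (Fin n) ℝ) :
    (multivariateGaussian 0 T).map (fun y => -y) = multivariateGaussian 0 T := by
  by_cases hT : T.PosSemidef
  · have : IsProbabilityMeasure ((multivariateGaussian 0 T).map (fun y => -y)) :=
      Measure.isProbabilityMeasure_map (by fun_prop)
    apply Measure.ext_of_charFun
    ext t
    have h : (fun y : EuclideanSpace ℝ (Fin n) => -y) = fun y => (-1 : ℝ) • y := by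
      ext y; simp
    rw [h, charFun_map_smul, charFun_multivariateGaussian hT, charFun_multivariateGaussian hT]
    simp [Matrix.mulVec_neg]
  -- Without positive semidefiniteness the measure is by convention a point mass, here at 0.
  · rw [multivariateGaussian_of_not_posSemidef _ hT, Measure.map_dirac' measurable_neg, neg_zero]

theorem multivariateGaussian_conv {T₁ T₂ : Matrix (Fin n) (Fin n) ℝ} (h₁ : T₁.PosSemidef)
    (h₂ : T₂.PosSemidef) :
    Measure.conv (multivariateGaussian 0 T₁) (multivariateGaussian 0 T₂)
      = multivariateGaussian 0 (T₁ + T₂) := by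
  apply Measure.ext_of_charFun
  ext t
  rw [charFun_conv, charFun_multivariateGaussian h₁, charFun_multivariateGaussian h₂,
    charFun_multivariateGaussian (h₁.add h₂), ← Complex.exp_add, Matrix.add_mulVec, dotProduct_add]
  congr 1
  push_cast
  simp only [inner_zero_right, Complex.ofReal_zero, zero_mul, zero_sub]
  ring

theorem multivariateGaussian_zero_zero :
    multivariateGaussian 0 (0 : Matrix (Fin n) (Fin n) ℝ) = Measure.dirac 0 := by
  simp [multivariateGaussian]

theorem one_le_cOne (c : ℝ) : 1 ≤ cOne c := by
  unfold cOne
  have : 0 ≤ psiTwoNormal ^ 2 / Real.sqrt c := by positivity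
  linarith

/-- The value of c₁ is made for this: the deviation t = K_g²√n/√c turns the exponent c t²/K_g⁴ into
n. -/
theorem stdGaussian_norm_tail {c : ℝ} (hc : 0 < c) (h : IsNormConcentrationConstant c) (n : ℕ) :
    (stdGaussian (EuclideanSpace ℝ (Fin n))).real {x | cOne c * Real.sqrt n ≤ ‖x‖}
      ≤ 2 * Real.exp (-n) := by
  have hK := psiTwoNormal_pos
  have hsc : 0 < Real.sqrt c := Real.sqrt_pos.2 hc
  have h0 := h n (psiTwoNormal ^ 2 / Real.sqrt c * Real.sqrt n) (by positivity)
  have e : c * (psiTwoNormal ^ 2 / Real.sqrt c * Real.sqrt n) ^ 2 / psiTwoNormal ^ 4 = n := by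
    rw [mul_pow, div_pow, Real.sq_sqrt hc.le, Real.sq_sqrt (Nat.cast_nonneg n)]
    field_simp
  rw [e] at h0
  refine (measureReal_mono fun x hx => ?_).trans h0
  have hx' : cOne c * Real.sqrt n ≤ ‖x‖ := hx
  rw [cOne, add_mul, one_mul] at hx'
  exact le_trans (by linarith) (le_abs_self (‖x‖ - Real.sqrt n))

/-- The form bound a replaces λ₁(T) so that sums of covariances can be treated additively. The
strict inequality covers the degenerate case a = 0, where the event is empty. -/
theorem multivariateGaussian_norm_tail {c : ℝ} (hc : 0 < c) (h : IsNormConcentrationConstant c)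
    (hT : T.PosSemidef) {a : ℝ}
    (ha : ∀ x, inner ℝ x (Matrix.toEuclideanCLM (𝕜 := ℝ) T x) ≤ a * ‖x‖ ^ 2) :
    (multivariateGaussian 0 T).real {x | cOne c * Real.sqrt (n * a) < ‖x‖}
      ≤ 2 * Real.exp (-n) := by
  rw [multivariateGaussian, map_measureReal_apply (by fun_prop)
    (measurableSet_lt measurable_const measurable_norm)]
  refine (measureReal_mono fun x hx => ?_).trans (stdGaussian_norm_tail hc h n)
  have hx' : cOne c * Real.sqrt (n * a) < ‖0 + Matrix.toEuclideanCLM (𝕜 := ℝ) (CFC.sqrt T) x‖ := hx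
  rw [zero_add, Real.sqrt_mul (Nat.cast_nonneg n)] at hx'
  have h2 := hx'.trans_le (sqrtNorm_le_of_forall hT ha x)
  show cOne c * Real.sqrt n ≤ ‖x‖
  by_contra! hlt
  nlinarith [mul_le_mul_of_nonneg_left hlt.le (Real.sqrt_nonneg a)]

end MultivariateGaussian

/-! ### The law of the signed noise and of its sum -/

section Mixture

variable {n m : ℕ} {Ω : Type*} [MeasurableSpace Ω] {P : Measure Ω}
  {S : ℤˣ → Matrix (Fin n) (Fin n) ℝ} {θ : Fin m → Ω → ℤˣ}
  {g : Fin m → ℤˣ → Ω → EuclideanSpace ℝ (Fin n)}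

theorem sum_intUnits {M : Type*} [AddCommMonoid M] (f : ℤˣ → M) : ∑ k, f k = f 1 + f (-1) := by
  rw [show (Finset.univ : Finset ℤˣ) = {1, -1} from rfl, Finset.sum_pair (by decide)]

instance measurableSingletonClass_intUnits : MeasurableSingletonClass ℤˣ where
  measurableSet_singleton k := by
    have h : ({k} : Set ℤˣ) = Units.val ⁻¹' {(k : ℤ)} := by
      ext j
      simp [Units.val_inj]
    rw [h]
    exact (comap_measurable Units.val) (measurableSet_singleton _)

theorem measurable_label_uncurry {α β : Type*} [MeasurableSpace α] [MeasurableSpace β]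
    {F : ℤˣ → α → β} (hF : ∀ k, Measurable (F k)) :
    Measurable (fun p : ℤˣ × (ℤˣ → α) => F p.1 (p.2 p.1)) :=
  measurable_from_prod_countable_right fun k => (hF k).comp (measurable_pi_apply k)

namespace IsMixtureSample

theorem iIndepFun_label_noise (h : IsMixtureSample P S θ g) {β : Type*} [MeasurableSpace β]
    {F : ℤˣ → EuclideanSpace ℝ (Fin n) → β} (hF : ∀ k, Measurable (F k)) :
    iIndepFun (fun i ω => F (θ i ω) (g i (θ i ω) ω)) P :=
  h.indep_draws.comp (fun _ p => F p.1 (p.2 p.1)) fun _ => measurable_label_uncurry hF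

theorem measurable_label_noise (h : IsMixtureSample P S θ g) (hg : ∀ i k, Measurable (g i k))
    {β : Type*} [MeasurableSpace β] {F : ℤˣ → EuclideanSpace ℝ (Fin n) → β}
    (hF : ∀ k, Measurable (F k)) (i : Fin m) :
    Measurable (fun ω => F (θ i ω) (g i (θ i ω) ω)) :=
  (measurable_label_uncurry hF).comp
    ((h.measurable_label i).prodMk (measurable_pi_lambda _ fun k => hg i k))

theorem lintegral_label_noise (h : IsMixtureSample P S θ g) (hg : ∀ i k, Measurable (g i k))
    (i : Fin m) {F : ℤˣ → EuclideanSpace ℝ (Fin n) → ℝ≥0∞} (hF : ∀ k, Measurable (F k)) :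
    ∫⁻ ω, F (θ i ω) (g i (θ i ω) ω) ∂P
      = ∑ k, 2⁻¹ * ∫⁻ y, F k y ∂(multivariateGaussian 0 (S k)) := by
  have hset : ∀ k, MeasurableSet (θ i ⁻¹' {k}) := fun k =>
    h.measurable_label i (measurableSet_singleton k)
  have hpt : ∀ ω, F (θ i ω) (g i (θ i ω) ω)
      = ∑ k, (θ i ⁻¹' {k}).indicator 1 ω * F k (g i k ω) := by
    intro ω
    rw [Finset.sum_eq_single (θ i ω)]
    · simp
    · intro k _ hk
      simp [Set.indicator_of_notMem, hk.symm]
    · exact fun hk => absurd (Finset.mem_univ _) hk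
  simp only [hpt]
  rw [lintegral_finsetSum _ fun k _ => by
    exact (measurable_one.indicator (hset k)).mul ((hF k).comp (hg i k))]
  refine Finset.sum_congr rfl fun k _ => ?_
  have hind : IndepFun (fun ω => (θ i ⁻¹' {k}).indicator (1 : Ω → ℝ≥0∞) ω)
      (fun ω => F k (g i k ω)) P :=
    (h.indep_label_noise i).comp
      (φ := ({k} : Set ℤˣ).indicator (1 : ℤˣ → ℝ≥0∞)) (ψ := fun f : ℤˣ → EuclideanSpace ℝ (Fin n) => F k (f k))
      (measurable_one.indicator (measurableSet_singleton k))
      ((hF k).comp (measurable_pi_apply k))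
  rw [lintegral_mul_eq_lintegral_mul_lintegral_of_indepFun''
    (measurable_one.indicator (hset k)).aemeasurable
    (show AEMeasurable (fun ω => F k (g i k ω)) P from ((hF k).comp (hg i k)).aemeasurable) hind,
    lintegral_indicator_one (hset k), show P (θ i ⁻¹' {k}) = 1 / 2 from h.rademacher i k,
    one_div, ← (h.gaussian i k).map_eq, lintegral_map (hF k) (hg i k)]

/-- Centred Gaussians are symmetric, so the sign in front of the noise leaves each component's law
unchanged. -/
theorem map_label_smul_noise (h : IsMixtureSample P S θ g) (hg : ∀ i k, Measurable (g i k))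
    (i : Fin m) :
    P.map (fun ω => ((θ i ω : ℤ) : ℝ) • g i (θ i ω) ω)
      = (2⁻¹ : ℝ≥0∞) • (multivariateGaussian 0 (S 1) + multivariateGaussian 0 (S (-1))) := by
  have hF : ∀ k : ℤˣ, Measurable (fun y : EuclideanSpace ℝ (Fin n) => ((k : ℤ) : ℝ) • y) :=
    fun k => by fun_prop
  ext B hB
  rw [Measure.map_apply (h.measurable_label_noise hg hF i) hB,
    ← lintegral_indicator_one (h.measurable_label_noise hg hF i hB)]
  have hl := h.lintegral_label_noise hg i
    (F := fun k y => B.indicator (1 : EuclideanSpace ℝ (Fin n) → ℝ≥0∞) (((k : ℤ) : ℝ) • y))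
    (fun k => (measurable_one.indicator hB).comp (hF k))
  refine Eq.trans hl ?_
  have hneg : ∫⁻ y, B.indicator (1 : EuclideanSpace ℝ (Fin n) → ℝ≥0∞) (-y)
      ∂(multivariateGaussian 0 (S (-1))) = multivariateGaussian 0 (S (-1)) B := by
    rw [← lintegral_map (μ := multivariateGaussian 0 (S (-1))) (g := fun y => -y)
      (measurable_one.indicator hB) measurable_neg, multivariateGaussian_neg,
      lintegral_indicator_one hB]
  rw [sum_intUnits]
  simp only [Units.val_one, Units.val_neg, Int.cast_one, Int.cast_neg, one_smul, neg_smul, hneg,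
    lintegral_indicator_one hB]
  simp

variable [IsProbabilityMeasure P]

/-- The sum is a mixture of Gaussians, one for each choice of labels, all with forms bounded by
|s|·L. Convolving with an arbitrary N(0, T) makes this an induction that never lists the label
patterns: each new draw is absorbed into T. -/
theorem conv_sum_tail (h : IsMixtureSample P S θ g) (hg : ∀ i k, Measurable (g i k))
    (hS : ∀ k, (S k).PosSemidef) {L : ℝ}
    (hL : ∀ k x, inner ℝ x (Matrix.toEuclideanCLM (𝕜 := ℝ) (S k) x) ≤ L * ‖x‖ ^ 2)
    {c : ℝ} (hc : 0 < c) (hconc : IsNormConcentrationConstant c) (s : Finset (Fin m)) :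
    ∀ (T : Matrix (Fin n) (Fin n) ℝ) (a : ℝ), T.PosSemidef →
      (∀ x, inner ℝ x (Matrix.toEuclideanCLM (𝕜 := ℝ) T x) ≤ a * ‖x‖ ^ 2) →
      (Measure.conv (multivariateGaussian 0 T)
        (P.map (∑ i ∈ s, fun ω => ((θ i ω : ℤ) : ℝ) • g i (θ i ω) ω)))
        {x | cOne c * Real.sqrt (n * (a + s.card * L)) < ‖x‖}
      ≤ ENNReal.ofReal (2 * Real.exp (-n)) := by
  have hF : ∀ k : ℤˣ, Measurable (fun y : EuclideanSpace ℝ (Fin n) => ((k : ℤ) : ℝ) • y) :=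
    fun k => by fun_prop
  have hmeas := h.measurable_label_noise hg hF
  have hind := h.iIndepFun_label_noise hF
  induction s using Finset.cons_induction with
  | empty =>
    intro T a hT ha
    have e : P.map (∑ i ∈ (∅ : Finset (Fin m)), fun ω => ((θ i ω : ℤ) : ℝ) • g i (θ i ω) ω)
        = Measure.dirac 0 := by
      rw [Finset.sum_empty]
      have := Measure.map_const P (0 : EuclideanSpace ℝ (Fin n))
      rw [measure_univ, one_smul] at this
      exact this
    rw [e, Measure.conv_dirac_zero, Finset.card_empty, Nat.cast_zero, zero_mul, add_zero]
    rw [← ofReal_measureReal]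
    exact ENNReal.ofReal_le_ofReal (multivariateGaussian_norm_tail hc hconc hT ha)
  | cons i s hi ih =>
    intro T a hT ha
    have hm : Measurable (∑ i ∈ s, fun ω => ((θ i ω : ℤ) : ℝ) • g i (θ i ω) ω) := by
      convert Finset.measurable_sum s fun i _ => hmeas i using 1
      ext1 ω
      exact Finset.sum_apply _ _ _
    have : IsProbabilityMeasure (P.map (∑ i ∈ s, fun ω => ((θ i ω : ℤ) : ℝ) • g i (θ i ω) ω)) :=
      Measure.isProbabilityMeasure_map hm.aemeasurable
    rw [Finset.sum_cons, (hind.indepFun_finsetSum_of_notMem hmeas hi).symm.map_add_eq_map_conv_map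
      (hmeas i) hm, h.map_label_smul_noise hg i,
      Measure.conv_smul_left, Measure.conv_comm, Measure.conv_smul_left, Measure.conv_comm,
      Measure.add_conv, Measure.conv_add, ← Measure.conv_assoc, ← Measure.conv_assoc,
      multivariateGaussian_conv hT (hS 1), multivariateGaussian_conv hT (hS (-1))]
    have hstep : ∀ k, (Measure.conv (multivariateGaussian 0 (T + S k))
        (P.map (∑ i ∈ s, fun ω => ((θ i ω : ℤ) : ℝ) • g i (θ i ω) ω)))
        {x | cOne c * Real.sqrt (n * (a + (Finset.cons i s hi).card * L)) < ‖x‖}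
        ≤ ENNReal.ofReal (2 * Real.exp (-n)) := by
      intro k
      -- Either component adds at most L to the form bound, so both halves of the mixture obey the
      -- same estimate.
      have := ih (T + S k) (a + L) (hT.add (hS k)) fun x => by
        rw [map_add, add_apply, inner_add_right, add_mul]
        exact add_le_add (ha x) (hL k x)
      rw [Finset.card_cons, Nat.cast_add, Nat.cast_one,
        show a + (s.card + 1) * L = a + L + s.card * L by ring]
      exact this
    rw [Measure.smul_apply, Measure.add_apply, smul_eq_mul]
    calc _ ≤ 2⁻¹ * (ENNReal.ofReal (2 * Real.exp (-n)) + ENNReal.ofReal (2 * Real.exp (-n))) := by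
          gcongr
          · exact hstep 1
          · exact hstep (-1)
      _ = _ := by
          rw [← two_mul, ← mul_assoc, ENNReal.inv_mul_cancel (by simp) (by simp), one_mul]

theorem mean_noise_tail (h : IsMixtureSample P S θ g) (hg : ∀ i k, Measurable (g i k))
    (hS : ∀ k, (S k).PosSemidef) {L : ℝ}
    (hL : ∀ k x, inner ℝ x (Matrix.toEuclideanCLM (𝕜 := ℝ) (S k) x) ≤ L * ‖x‖ ^ 2)
    {c : ℝ} (hc : 0 < c) (hconc : IsNormConcentrationConstant c) :
    P.real {ω | cOne c * Real.sqrt (n * (m * L))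
      < ‖∑ i, ((θ i ω : ℤ) : ℝ) • g i (θ i ω) ω‖} ≤ 2 * Real.exp (-n) := by
  have hF : ∀ k : ℤˣ, Measurable (fun y : EuclideanSpace ℝ (Fin n) => ((k : ℤ) : ℝ) • y) :=
    fun k => by fun_prop
  have hmeas := h.measurable_label_noise hg hF
  have htail := h.conv_sum_tail hg hS hL hc hconc Finset.univ 0 0 .zero (by simp)
  have hm : Measurable (∑ i, fun ω => ((θ i ω : ℤ) : ℝ) • g i (θ i ω) ω) := by
    convert Finset.measurable_sum Finset.univ fun i _ => hmeas i using 1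
    ext1 ω
    exact Finset.sum_apply _ _ _
  have : IsProbabilityMeasure (P.map (∑ i, fun ω => ((θ i ω : ℤ) : ℝ) • g i (θ i ω) ω)) :=
    Measure.isProbabilityMeasure_map hm.aemeasurable
  rw [multivariateGaussian_zero_zero, Measure.dirac_zero_conv,
    Measure.map_apply hm (measurableSet_lt measurable_const measurable_norm), Finset.card_univ,
    Fintype.card_fin, zero_add] at htail
  refine ENNReal.toReal_le_of_le_ofReal (by positivity) ?_
  convert htail using 2
  ext ω
  simp

end IsMixtureSample

end Mixture

/-! ### Uniform bounds for a quadratic form from a volume integral -/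

section SphereDeviation

variable {n : ℕ}

/-- A quadratic form that attains its norm N at v stays above N/2 on the ball of radius 1/8 about v,
by the parallelogram law. That ball fills a fraction 9⁻ⁿ ≥ e⁻³ⁿ of the ball of radius 9/8, so a
bound on the integral of exp(s q) bounds N. -/
theorem exp_mul_le_of_setLIntegral_le [Nonempty (Fin n)] {q : EuclideanSpace ℝ (Fin n) → ℝ}
    (hpar : ∀ x y, q (x + y) + q (x - y) = 2 * q x + 2 * q y) {N : ℝ}
    (hN : ∀ x, |q x| ≤ N * ‖x‖ ^ 2) {v : EuclideanSpace ℝ (Fin n)} (hv : ‖v‖ = 1) (hqv : q v = N)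
    {s b : ℝ} (hs : 0 < s)
    (h : ∫⁻ x in Metric.closedBall 0 (9 / 8), ENNReal.ofReal (Real.exp (s * q x))
      ≤ ENNReal.ofReal (Real.exp b)
        * volume (Metric.closedBall (0 : EuclideanSpace ℝ (Fin n)) (9 / 8))) :
    s * N ≤ 2 * (b + 3 * n) := by
  have hN0 : 0 ≤ N := by
    have := (abs_nonneg _).trans (hN v)
    simpa [hv] using this
  have hlow : ∀ x ∈ Metric.closedBall v (1 / 8), N / 2 ≤ q x := by
    intro x hx
    rw [mem_closedBall_iff_norm] at hx
    have h1 := hpar v (x - v)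
    rw [add_sub_cancel] at h1
    have h2 := (abs_le.1 (hN (x - v))).1
    have h3 := (abs_le.1 (hN (v - (x - v)))).2
    have h4 : ‖v - (x - v)‖ ≤ 9 / 8 := (norm_sub_le _ _).trans (by rw [hv]; linarith)
    have h5 : ‖x - v‖ ^ 2 ≤ (1 / 8) ^ 2 := pow_le_pow_left₀ (norm_nonneg _) hx 2
    have h6 : ‖v - (x - v)‖ ^ 2 ≤ (9 / 8) ^ 2 := pow_le_pow_left₀ (norm_nonneg _) h4 2
    have h7 := mul_le_mul_of_nonneg_left h5 hN0
    have h8 := mul_le_mul_of_nonneg_left h6 hN0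
    rw [hqv] at h1
    linarith
  set V := volume (Metric.closedBall (0 : EuclideanSpace ℝ (Fin n)) (1 / 8))
  have hV0 : V ≠ 0 := (Metric.measure_closedBall_pos _ _ (by norm_num)).ne'
  have hVt : V ≠ ∞ := (isCompact_closedBall _ _).measure_lt_top.ne
  have hsub : Metric.closedBall v (1 / 8)
      ⊆ Metric.closedBall (0 : EuclideanSpace ℝ (Fin n)) (9 / 8) := by
    apply Metric.closedBall_subset_closedBall'
    rw [dist_zero_right, hv]; norm_num
  have h1 : ENNReal.ofReal (Real.exp (s * (N / 2))) * V
      ≤ ENNReal.ofReal (Real.exp b) * (ENNReal.ofReal (9 ^ n) * V) := by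
    calc _ = ∫⁻ _ in Metric.closedBall v (1 / 8), ENNReal.ofReal (Real.exp (s * (N / 2))) := by
          rw [setLIntegral_const, Measure.addHaar_closedBall_center]
      _ ≤ ∫⁻ x in Metric.closedBall v (1 / 8), ENNReal.ofReal (Real.exp (s * q x)) := by
          refine setLIntegral_mono' Metric.isClosed_closedBall.measurableSet fun x hx => ?_
          exact ENNReal.ofReal_le_ofReal
            (Real.exp_le_exp.2 (mul_le_mul_of_nonneg_left (hlow x hx) hs.le))
      _ ≤ _ := lintegral_mono_set hsub
      _ ≤ _ := h
      _ = _ := by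
          have := Measure.addHaar_closedBall_mul
            (volume : Measure (EuclideanSpace ℝ (Fin n))) 0 (r := 9) (by norm_num) (s := 1 / 8)
            (by norm_num)
          rw [finrank_euclideanSpace_fin, show (9 : ℝ) * (1 / 8) = 9 / 8 by norm_num] at this
          rw [this]
  rw [← mul_assoc, ENNReal.mul_le_mul_iff_left hV0 hVt,
    ← ENNReal.ofReal_mul (Real.exp_pos _).le, ENNReal.ofReal_le_ofReal_iff (by positivity)] at h1
  have h9 : (9 : ℝ) ^ n ≤ Real.exp (3 * n) := by
    rw [mul_comm, Real.exp_nat_mul]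
    refine pow_le_pow_left₀ (by norm_num) ?_ n
    have h27 : Real.exp 3 = Real.exp 1 ^ 3 := by rw [← Real.exp_nat_mul]; norm_num
    have he : (2.7 : ℝ) ≤ Real.exp 1 := by linarith [Real.exp_one_gt_d9]
    rw [h27]
    refine le_trans ?_ (pow_le_pow_left₀ (by norm_num) he 3)
    norm_num
  have h10 := h1.trans (mul_le_mul_of_nonneg_left h9 (Real.exp_pos b).le)
  rw [← Real.exp_add, Real.exp_le_exp] at h10
  linarith

/-- The maximum of |q| on the sphere may come from q or from -q, which is why both exponentials are
integrated. -/
theorem mul_abs_le_of_setLIntegral_le [Nonempty (Fin n)] {q : EuclideanSpace ℝ (Fin n) → ℝ}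
    (hq : Continuous q) (hpar : ∀ x y, q (x + y) + q (x - y) = 2 * q x + 2 * q y)
    (hsmul : ∀ (t : ℝ) x, q (t • x) = t ^ 2 * q x) {s b : ℝ} (hs : 0 < s)
    (h : ∫⁻ x in Metric.closedBall 0 (9 / 8), (ENNReal.ofReal (Real.exp (s * q x))
        + ENNReal.ofReal (Real.exp (-s * q x)))
      ≤ ENNReal.ofReal (Real.exp b)
        * volume (Metric.closedBall (0 : EuclideanSpace ℝ (Fin n)) (9 / 8)))
    (x : EuclideanSpace ℝ (Fin n)) :
    s * |q x| ≤ 2 * (b + 3 * n) * ‖x‖ ^ 2 := by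
  obtain ⟨v, hv, hmax⟩ := (isCompact_sphere (0 : EuclideanSpace ℝ (Fin n)) 1).exists_isMaxOn
    (NormedSpace.sphere_nonempty.2 zero_le_one) (hq.abs.continuousOn)
  rw [mem_sphere_zero_iff_norm] at hv
  have hN : ∀ x, |q x| ≤ |q v| * ‖x‖ ^ 2 := by
    intro x
    rcases eq_or_ne x 0 with rfl | hx
    · have := hsmul 0 0
      simp at this
      simp [this]
    · have hx' : ‖x‖ ≠ 0 := norm_ne_zero_iff.2 hx
      have hu : ‖x‖⁻¹ • x ∈ Metric.sphere (0 : EuclideanSpace ℝ (Fin n)) 1 := by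
        rw [mem_sphere_zero_iff_norm, norm_smul, norm_inv, norm_norm, inv_mul_cancel₀ hx']
      have h1 : |q (‖x‖⁻¹ • x)| ≤ |q v| := hmax hu
      have h2 : q x = ‖x‖ ^ 2 * q (‖x‖⁻¹ • x) := by
        rw [hsmul]; field_simp
      rw [h2, abs_mul, abs_of_nonneg (sq_nonneg ‖x‖), mul_comm]
      exact mul_le_mul_of_nonneg_right h1 (sq_nonneg _)
  have key : s * |q v| ≤ 2 * (b + 3 * n) := by
    rcases abs_choice (q v) with h0 | h0
    · exact exp_mul_le_of_setLIntegral_le hpar hN hv h0.symm hs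
        ((lintegral_mono fun x => le_self_add).trans h)
    · refine exp_mul_le_of_setLIntegral_le (q := fun x => -q x)
        (fun x y => by linarith [hpar x y]) (fun x => by rw [abs_neg]; exact hN x) hv h0.symm hs
        ((lintegral_mono fun x => ?_).trans h)
      rw [mul_neg, ← neg_mul]
      exact le_add_self
  calc s * |q x| ≤ s * (|q v| * ‖x‖ ^ 2) := mul_le_mul_of_nonneg_left (hN x) hs.le
    _ = s * |q v| * ‖x‖ ^ 2 := by ring
    _ ≤ _ := mul_le_mul_of_nonneg_right key (sq_nonneg _)

end SphereDeviation

/-! ### Deviation of the noise second-moment matrix -/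

section SampleCovariance

variable {n m : ℕ} {Ω : Type*} [MeasurableSpace Ω] {P : Measure Ω}
  {S : ℤˣ → Matrix (Fin n) (Fin n) ℝ} {θ : Fin m → Ω → ℤˣ}
  {g : Fin m → ℤˣ → Ω → EuclideanSpace ℝ (Fin n)}

/-- The quadratic form of the average covariance matrix `(Σ₋₁ + Σ₁) / 2`. -/
noncomputable def meanForm (S : ℤˣ → Matrix (Fin n) (Fin n) ℝ) (x : EuclideanSpace ℝ (Fin n)) : ℝ :=
  2⁻¹ * (sqrtNorm (S 1) x ^ 2 + sqrtNorm (S (-1)) x ^ 2)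

/-- The centred quadratic form of a finite family of vectors. -/
noncomputable def centredForm (S : ℤˣ → Matrix (Fin n) (Fin n) ℝ) (y : Fin m → EuclideanSpace ℝ (Fin n))
    (x : EuclideanSpace ℝ (Fin n)) : ℝ :=
  ∑ i, (inner ℝ x (y i) ^ 2 - meanForm S x)

theorem continuous_sqrtNorm (A : Matrix (Fin n) (Fin n) ℝ) : Continuous (sqrtNorm A) := by
  unfold sqrtNorm
  fun_prop

theorem continuous_meanForm (S : ℤˣ → Matrix (Fin n) (Fin n) ℝ) : Continuous (meanForm S) :=
  ((((continuous_sqrtNorm _).pow 2).add ((continuous_sqrtNorm _).pow 2))).const_mul _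

theorem meanForm_parallelogram (S : ℤˣ → Matrix (Fin n) (Fin n) ℝ)
    (x y : EuclideanSpace ℝ (Fin n)) :
    meanForm S (x + y) + meanForm S (x - y) = 2 * meanForm S x + 2 * meanForm S y := by
  have h : ∀ A : Matrix (Fin n) (Fin n) ℝ, sqrtNorm A (x + y) ^ 2 + sqrtNorm A (x - y) ^ 2
      = 2 * sqrtNorm A x ^ 2 + 2 * sqrtNorm A y ^ 2 := by
    intro A
    simp only [sqrtNorm, map_add, map_sub]
    linarith [parallelogram_law_with_norm ℝ (Matrix.toEuclideanCLM (𝕜 := ℝ) (CFC.sqrt A) x)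
      (Matrix.toEuclideanCLM (𝕜 := ℝ) (CFC.sqrt A) y)]
  unfold meanForm
  linarith [h (S 1), h (S (-1))]

theorem meanForm_smul (S : ℤˣ → Matrix (Fin n) (Fin n) ℝ) (t : ℝ)
    (x : EuclideanSpace ℝ (Fin n)) : meanForm S (t • x) = t ^ 2 * meanForm S x := by
  simp only [meanForm, sqrtNorm, map_smul, norm_smul, mul_pow, Real.norm_eq_abs, sq_abs]
  ring

theorem continuous_centredForm (S : ℤˣ → Matrix (Fin n) (Fin n) ℝ)
    (y : Fin m → EuclideanSpace ℝ (Fin n)) : Continuous (centredForm S y) := by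
  have := continuous_meanForm S
  unfold centredForm
  fun_prop

theorem measurable_centredForm {α : Type*} [MeasurableSpace α]
    (S : ℤˣ → Matrix (Fin n) (Fin n) ℝ) {y : Fin m → α → EuclideanSpace ℝ (Fin n)}
    {x : α → EuclideanSpace ℝ (Fin n)} (hy : ∀ i, Measurable (y i)) (hx : Measurable x) :
    Measurable (fun p => centredForm S (fun i => y i p) (x p)) := by
  have := (continuous_meanForm S).measurable
  unfold centredForm
  exact Finset.measurable_sum _ fun i _ => ((hx.inner (hy i)).pow_const 2).sub (this.comp hx)

theorem centredForm_parallelogram (S : ℤˣ → Matrix (Fin n) (Fin n) ℝ)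
    (y : Fin m → EuclideanSpace ℝ (Fin n)) (u v : EuclideanSpace ℝ (Fin n)) :
    centredForm S y (u + v) + centredForm S y (u - v)
      = 2 * centredForm S y u + 2 * centredForm S y v := by
  simp only [centredForm, Finset.mul_sum, ← Finset.sum_add_distrib]
  refine Finset.sum_congr rfl fun i _ => ?_
  rw [inner_add_left, inner_sub_left]
  linarith [meanForm_parallelogram S u v]

theorem centredForm_smul (S : ℤˣ → Matrix (Fin n) (Fin n) ℝ)
    (y : Fin m → EuclideanSpace ℝ (Fin n)) (t : ℝ) (x : EuclideanSpace ℝ (Fin n)) :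
    centredForm S y (t • x) = t ^ 2 * centredForm S y x := by
  simp only [centredForm, Finset.mul_sum]
  refine Finset.sum_congr rfl fun i _ => ?_
  rw [real_inner_smul_left, meanForm_smul]
  ring

namespace IsMixtureSample

/-- The centring is the average variance, not that of the component drawn, so neither component
alone is centred. The linear terms cancel only after averaging over the label, hence 1 + x ≤ eˣ is
applied last. -/
theorem lintegral_exp_centred_le (h : IsMixtureSample P S θ g) (hg : ∀ i k, Measurable (g i k))
    (hS : ∀ k, (S k).PosSemidef) {L : ℝ} (hL : ∀ k x, sqrtNorm (S k) x ^ 2 ≤ L * ‖x‖ ^ 2)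
    (hL0 : 0 < L) {x : EuclideanSpace ℝ (Fin n)} (hx : ‖x‖ ≤ 9 / 8) {s : ℝ}
    (hs : |s| * L ≤ 1 / 8) (i : Fin m) :
    ∫⁻ ω, ENNReal.ofReal (Real.exp (s * (inner ℝ x (g i (θ i ω) ω) ^ 2 - meanForm S x))) ∂P
      ≤ ENNReal.ofReal (Real.exp (16 * (s * L) ^ 2)) := by
  have hσ : ∀ k, sqrtNorm (S k) x ^ 2 ≤ 2 * L := fun k => (hL k x).trans <| by
    have : ‖x‖ ^ 2 ≤ (9 / 8) ^ 2 := pow_le_pow_left₀ (norm_nonneg _) hx 2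
    nlinarith
  have hsσ : ∀ k, |s * sqrtNorm (S k) x ^ 2| ≤ 2 * (|s| * L) := by
    intro k
    rw [abs_mul, abs_of_nonneg (sq_nonneg (sqrtNorm (S k) x))]
    nlinarith [mul_le_mul_of_nonneg_left (hσ k) (abs_nonneg s)]
  have hone : ∀ k, ∫⁻ y, ENNReal.ofReal (Real.exp (s * (inner ℝ x y ^ 2 - meanForm S x)))
      ∂(multivariateGaussian 0 (S k))
      ≤ ENNReal.ofReal (Real.exp (-(s * meanForm S x))
          * (1 + s * sqrtNorm (S k) x ^ 2 + 16 * (s * L) ^ 2)) := by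
    intro k
    have e : ∀ y, ENNReal.ofReal (Real.exp (s * (inner ℝ x y ^ 2 - meanForm S x)))
        = ENNReal.ofReal (Real.exp (-(s * meanForm S x)))
          * ENNReal.ofReal (Real.exp (s * inner ℝ x y ^ 2)) := by
      intro y
      rw [← ENNReal.ofReal_mul (Real.exp_pos _).le, ← Real.exp_add]
      congr 2
      ring
    simp only [e]
    rw [lintegral_const_mul _ (by fun_prop), ENNReal.ofReal_mul (Real.exp_pos _).le]
    have hk := hsσ k
    have hk' := abs_le.1 (hk.trans (by linarith : 2 * (|s| * L) ≤ 1 / 4))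
    refine mul_le_mul_right ((lintegral_exp_mul_inner_sq_le (hS k) x hk'.1 hk'.2).trans
      (ENNReal.ofReal_le_ofReal ?_)) _
    have h2 : (s * sqrtNorm (S k) x ^ 2) ^ 2 ≤ (2 * (|s| * L)) ^ 2 := by
      rw [← sq_abs (s * sqrtNorm (S k) x ^ 2)]
      exact pow_le_pow_left₀ (abs_nonneg _) hk 2
    have h3 : (2 * (|s| * L)) ^ 2 = 4 * (s * L) ^ 2 := by
      rw [mul_pow, mul_pow, mul_pow, sq_abs]; norm_num
    linarith
  have hnn : ∀ k, 0 ≤ 1 + s * sqrtNorm (S k) x ^ 2 + 16 * (s * L) ^ 2 := by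
    intro k
    have := (abs_le.1 (hsσ k)).1
    nlinarith [sq_nonneg (s * L)]
  rw [h.lintegral_label_noise hg i
    (F := fun _ y => ENNReal.ofReal (Real.exp (s * (inner ℝ x y ^ 2 - meanForm S x))))
    (fun k => by fun_prop), ← Finset.mul_sum, sum_intUnits]
  refine (mul_le_mul_right (add_le_add (hone 1) (hone (-1))) _).trans ?_
  rw [← ENNReal.ofReal_add (mul_nonneg (Real.exp_pos _).le (hnn _))
    (mul_nonneg (Real.exp_pos _).le (hnn _)), ← mul_add,
    show (2⁻¹ : ℝ≥0∞) = ENNReal.ofReal 2⁻¹ by rw [ENNReal.ofReal_inv_of_pos (by norm_num)]; simp,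
    ← ENNReal.ofReal_mul (by norm_num)]
  apply ENNReal.ofReal_le_ofReal
  have h4 := Real.add_one_le_exp (s * meanForm S x + 16 * (s * L) ^ 2)
  have h5 : Real.exp (16 * (s * L) ^ 2)
      = Real.exp (-(s * meanForm S x)) * Real.exp (s * meanForm S x + 16 * (s * L) ^ 2) := by
    rw [← Real.exp_add]; congr 1; ring
  rw [h5, mul_left_comm]
  refine mul_le_mul_of_nonneg_left ?_ (Real.exp_pos _).le
  refine le_trans (le_of_eq ?_) h4
  unfold meanForm
  ring

theorem lintegral_exp_centredForm_le (h : IsMixtureSample P S θ g)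
    (hg : ∀ i k, Measurable (g i k)) (hS : ∀ k, (S k).PosSemidef) {L : ℝ}
    (hL : ∀ k x, sqrtNorm (S k) x ^ 2 ≤ L * ‖x‖ ^ 2) (hL0 : 0 < L)
    {x : EuclideanSpace ℝ (Fin n)} (hx : ‖x‖ ≤ 9 / 8) {s : ℝ} (hs : |s| * L ≤ 1 / 8) :
    ∫⁻ ω, ENNReal.ofReal (Real.exp (s * centredForm S (fun i => g i (θ i ω) ω) x)) ∂P
      ≤ ENNReal.ofReal (Real.exp (m * (16 * (s * L) ^ 2))) := by
  have hF : ∀ _ : ℤˣ, Measurable (fun y : EuclideanSpace ℝ (Fin n) =>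
      ENNReal.ofReal (Real.exp (s * (inner ℝ x y ^ 2 - meanForm S x)))) := fun _ => by fun_prop
  have e : ∀ ω, ENNReal.ofReal (Real.exp (s * centredForm S (fun i => g i (θ i ω) ω) x))
      = ∏ i, ENNReal.ofReal (Real.exp (s * (inner ℝ x (g i (θ i ω) ω) ^ 2 - meanForm S x))) := by
    intro ω
    rw [← ENNReal.ofReal_prod_of_nonneg fun i _ => (Real.exp_pos _).le, ← Real.exp_sum,
      ← Finset.mul_sum]
    rfl
  simp only [e]
  rw [lintegral_prod_eq_prod_lintegral_of_indepFun _ _ (h.iIndepFun_label_noise hF)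
    (h.measurable_label_noise hg hF)]
  refine (Finset.prod_le_prod' fun i _ =>
    h.lintegral_exp_centred_le hg hS hL hL0 hx hs i).trans ?_
  rw [Finset.prod_const, Finset.card_univ, Fintype.card_fin, ← ENNReal.ofReal_pow (by positivity),
    ← Real.exp_nat_mul]

variable [IsProbabilityMeasure P]

theorem centredForm_deviation [Nonempty (Fin n)] (h : IsMixtureSample P S θ g)
    (hg : ∀ i k, Measurable (g i k)) (hS : ∀ k, (S k).PosSemidef) {L : ℝ}
    (hL : ∀ k x, sqrtNorm (S k) x ^ 2 ≤ L * ‖x‖ ^ 2) (hL0 : 0 < L)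
    {s : ℝ} (hs0 : 0 < s) (hs : s * L ≤ 1 / 8) :
    P.real {ω | ∃ x, 2 * (m * (16 * (s * L) ^ 2) + 5 * n) * ‖x‖ ^ 2
      < s * |centredForm S (fun i => g i (θ i ω) ω) x|} ≤ Real.exp (-n) := by
  set V := volume (Metric.closedBall (0 : EuclideanSpace ℝ (Fin n)) (9 / 8))
  have hV0 : V ≠ 0 := (Metric.measure_closedBall_pos _ _ (by norm_num)).ne'
  have hVt : V ≠ ∞ := (isCompact_closedBall _ _).measure_lt_top.ne
  set a := (m : ℝ) * (16 * (s * L) ^ 2)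
  set f : Ω → EuclideanSpace ℝ (Fin n) → ℝ≥0∞ := fun ω x =>
    ENNReal.ofReal (Real.exp (s * centredForm S (fun i => g i (θ i ω) ω) x))
      + ENNReal.ofReal (Real.exp (-s * centredForm S (fun i => g i (θ i ω) ω) x)) with hf
  set Z : Ω → ℝ≥0∞ := fun ω => ∫⁻ x in Metric.closedBall 0 (9 / 8), f ω x with hZ
  have hnoise : ∀ i, Measurable (fun ω => g i (θ i ω) ω) := fun i =>
    h.measurable_label_noise hg (β := EuclideanSpace ℝ (Fin n)) (F := fun _ y => y)
      (fun _ => measurable_id) i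
  have hform : Measurable (fun p : Ω × EuclideanSpace ℝ (Fin n) =>
      centredForm S (fun i => g i (θ i p.1) p.1) p.2) :=
    measurable_centredForm S (α := Ω × EuclideanSpace ℝ (Fin n))
      (y := fun i p => g i (θ i p.1) p.1) (x := fun p => p.2)
      (fun i => (hnoise i).comp measurable_fst) measurable_snd
  have hfm : Measurable (Function.uncurry f) := by
    show Measurable fun p : Ω × EuclideanSpace ℝ (Fin n) => f p.1 p.2
    simp only [hf]
    fun_prop
  have hZm : Measurable Z := hfm.lintegral_prod_right
  have hEZ : ∫⁻ ω, Z ω ∂P ≤ 2 * ENNReal.ofReal (Real.exp a) * V := by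
    rw [hZ, lintegral_lintegral_swap hfm.aemeasurable]
    have hconst : ∫⁻ _ in Metric.closedBall (0 : EuclideanSpace ℝ (Fin n)) (9 / 8),
        2 * ENNReal.ofReal (Real.exp a) = 2 * ENNReal.ofReal (Real.exp a) * V :=
      setLIntegral_const _ _
    rw [← hconst]
    refine setLIntegral_mono' Metric.isClosed_closedBall.measurableSet fun x hx => ?_
    rw [mem_closedBall_zero_iff] at hx
    have hsec : Measurable fun ω => centredForm S (fun i => g i (θ i ω) ω) x :=
      measurable_centredForm S hnoise measurable_const
    simp only [hf]
    rw [lintegral_add_left (by fun_prop), two_mul]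
    refine add_le_add ?_ ?_
    · exact h.lintegral_exp_centredForm_le hg hS hL hL0 hx (by rwa [abs_of_pos hs0])
    · have := h.lintegral_exp_centredForm_le hg hS hL hL0 hx (s := -s)
        (by rwa [abs_neg, abs_of_pos hs0])
      rwa [neg_mul s L, neg_sq] at this
  have hn1 : (1 : ℝ) ≤ n := by
    have : 0 < n := Fin.pos_iff_nonempty.2 inferInstance
    exact_mod_cast this
  -- The expected integral is at most 2eᵃV, so this threshold leaves probability 2e⁻²ⁿ, which is at
  -- most e⁻ⁿ since 2 ≤ 1 + n ≤ eⁿ. The volume argument adds 3n to a + 2n, whence the 5n.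
  set ε := ENNReal.ofReal (Real.exp (a + 2 * n)) * V with hε
  have hε0 : ε ≠ 0 := mul_ne_zero (by simp [Real.exp_pos]) hV0
  have hεt : ε ≠ ∞ := ENNReal.mul_ne_top (by simp) hVt
  have hmarkov : P {ω | ε ≤ Z ω} ≤ ENNReal.ofReal (Real.exp (-n)) := by
    refine (meas_ge_le_lintegral_div hZm.aemeasurable hε0 hεt).trans ?_
    rw [ENNReal.div_le_iff hε0 hεt]
    refine hEZ.trans ?_
    rw [hε, ← mul_assoc, ← ENNReal.ofReal_mul (Real.exp_pos _).le]
    refine mul_le_mul_left ?_ V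
    rw [show (2 : ℝ≥0∞) = ENNReal.ofReal 2 by simp, ← ENNReal.ofReal_mul (by norm_num),
      ← Real.exp_add]
    apply ENNReal.ofReal_le_ofReal
    rw [show -(n : ℝ) + (a + 2 * n) = n + a by ring, Real.exp_add]
    refine mul_le_mul_of_nonneg_right ?_ (Real.exp_pos _).le
    linarith [Real.add_one_le_exp (n : ℝ)]
  have hreal : P.real {ω | ε ≤ Z ω} ≤ Real.exp (-n) :=
    ENNReal.toReal_le_of_le_ofReal (Real.exp_pos _).le hmarkov
  refine le_trans (measureReal_mono ?_) hreal
  rintro ω ⟨x, hx⟩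
  by_contra hlt
  have hlt' : Z ω ≤ ε := (not_le.1 hlt).le
  have := mul_abs_le_of_setLIntegral_le
    (continuous_centredForm S fun i => g i (θ i ω) ω)
    (centredForm_parallelogram S _) (centredForm_smul S _) hs0 hlt' x
  rw [show a + 2 * n + 3 * n = a + 5 * (n : ℝ) by ring] at this
  exact absurd this (not_le.2 hx)

end IsMixtureSample

end SampleCovariance

/-! ### Tail and increment bounds for the normal distribution function -/

section NormalDistribution

theorem gaussianReal_real_eq_setIntegral (B : Set ℝ) :
    (gaussianReal 0 1).real B = ∫ x in B, gaussianPDFReal 0 1 x := by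
  rw [measureReal_def, gaussianReal_apply_eq_integral 0 one_ne_zero, ENNReal.toReal_ofReal]
  exact integral_nonneg fun x => gaussianPDFReal_nonneg 0 1 x

theorem gaussianPDFReal_zero_one (x : ℝ) :
    gaussianPDFReal 0 1 x = (Real.sqrt (2 * Real.pi))⁻¹ * Real.exp (-(x ^ 2) / 2) := by
  simp [gaussianPDFReal_def]

theorem gaussianPDFReal_zero_one_anti {x y : ℝ} (h : y ^ 2 ≤ x ^ 2) :
    gaussianPDFReal 0 1 x ≤ gaussianPDFReal 0 1 y := by
  rw [gaussianPDFReal_zero_one, gaussianPDFReal_zero_one]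
  refine mul_le_mul_of_nonneg_left (Real.exp_le_exp.2 ?_) (by positivity)
  linarith

/-- Mills' bound: (x + a)² ≥ 0 gives φ(x) ≤ φ(a) exp(a² + ax), and the right side integrates
explicitly. -/
theorem cdf_gaussianReal_neg_le {a : ℝ} (ha : 0 < a) :
    cdf (gaussianReal 0 1) (-a) ≤ gaussianPDFReal 0 1 a / a := by
  rw [cdf_eq_real, gaussianReal_real_eq_setIntegral]
  have hint : IntegrableOn (fun x => gaussianPDFReal 0 1 a * Real.exp (a * a) * Real.exp (a * x))
      (Set.Iic (-a)) := (integrableOn_exp_mul_Iic ha _).const_mul _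
  calc ∫ x in Set.Iic (-a), gaussianPDFReal 0 1 x
      ≤ ∫ x in Set.Iic (-a), gaussianPDFReal 0 1 a * Real.exp (a * a) * Real.exp (a * x) := by
        refine setIntegral_mono (integrable_gaussianPDFReal 0 1).integrableOn hint fun x => ?_
        rw [gaussianPDFReal_zero_one, gaussianPDFReal_zero_one, mul_assoc, mul_assoc,
          ← Real.exp_add, ← Real.exp_add]
        refine mul_le_mul_of_nonneg_left (Real.exp_le_exp.2 ?_) (by positivity)
        nlinarith [sq_nonneg (x + a)]
    _ = gaussianPDFReal 0 1 a / a := by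
        rw [integral_const_mul, integral_exp_mul_Iic ha, mul_neg, ← mul_div_assoc, mul_assoc,
          ← Real.exp_add, add_neg_cancel, Real.exp_zero, mul_one]

theorem cdf_gaussianReal_sub_le {x y : ℝ} (hxy : x ≤ y) (hy : y ≤ 0) :
    cdf (gaussianReal 0 1) y - cdf (gaussianReal 0 1) x ≤ (y - x) * gaussianPDFReal 0 1 y := by
  rw [cdf_eq_real, cdf_eq_real, ← measureReal_sdiff (Set.Iic_subset_Iic.2 hxy) measurableSet_Iic,
    Set.Iic_sdiff_Iic, gaussianReal_real_eq_setIntegral]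
  calc ∫ z in Set.Ioc x y, gaussianPDFReal 0 1 z
      ≤ ∫ _ in Set.Ioc x y, gaussianPDFReal 0 1 y := by
        refine setIntegral_mono_on (integrable_gaussianPDFReal 0 1).integrableOn
          (by simp) measurableSet_Ioc fun z hz => ?_
        apply gaussianPDFReal_zero_one_anti
        nlinarith [hz.2]
    _ = _ := by
        rw [setIntegral_const, Real.volume_real_Ioc_of_le hxy, smul_eq_mul]

/-- An upper bound for a probability by a perturbed normal tail is two-sided once the argument of
the tail is large compared with the relative perturbation. -/
theorem abs_sub_cdf_le {p A α ε : ℝ} (hp : 0 ≤ p) (hε : 0 ≤ ε) (hA : 0 < A) (hα : 0 < α)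
    (hα1 : α < 1) (hαA : 1 ≤ α * A ^ 2)
    (h : p ≤ cdf (gaussianReal 0 1) (-((1 - α) * A)) + ε) :
    |p - cdf (gaussianReal 0 1) (-A)|
      ≤ α * A * gaussianPDFReal 0 1 ((1 - α) * A) + ε := by
  rw [abs_le]
  constructor
  -- Here p ≥ 0 suffices: Φ(-A) ≤ φ(A)/A ≤ αAφ(A) ≤ αAφ((1-α)A).
  · have h1 := cdf_gaussianReal_neg_le hA
    have h2 : gaussianPDFReal 0 1 A ≤ gaussianPDFReal 0 1 ((1 - α) * A) := by
      apply gaussianPDFReal_zero_one_anti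
      refine pow_le_pow_left₀ (by nlinarith) ?_ 2
      nlinarith
    have h3 : gaussianPDFReal 0 1 A / A ≤ α * A * gaussianPDFReal 0 1 A := by
      rw [div_le_iff₀ hA]
      nlinarith [mul_le_mul_of_nonneg_right hαA (gaussianPDFReal_nonneg 0 1 A)]
    have h4 := mul_le_mul_of_nonneg_left h2 (mul_pos hα hA).le
    linarith
  · have h1 := cdf_gaussianReal_sub_le (x := -A) (y := -((1 - α) * A)) (by nlinarith)
      (by nlinarith)
    have h2 : gaussianPDFReal 0 1 (-((1 - α) * A)) = gaussianPDFReal 0 1 ((1 - α) * A) := by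
      simp [gaussianPDFReal_zero_one]
    rw [h2] at h1
    linarith

end NormalDistribution

/-! ### Deterministic estimates for the sample matrix and for misclassification -/

section SampleForms

variable {n m : ℕ}

/-- Since tᵢ² = 1, the μμᵀ part is exact and the cross terms see the noise only through the signed
sum. The remaining bilinear form follows from its quadratic form by Cauchy–Schwarz. -/
theorem inner_sampleMatrix_sub_le {t : Fin m → ℝ} (ht : ∀ i, t i ^ 2 = 1)
    {y : Fin m → EuclideanSpace ℝ (Fin n)} {μ : EuclideanSpace ℝ (Fin n)} (hm : 0 < m)
    {B H : ℝ} (hB : 0 ≤ B)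
    (hq : ∀ x, (m : ℝ)⁻¹ * ∑ i, inner ℝ x (y i) ^ 2 ≤ B * ‖x‖ ^ 2)
    (hH : ‖∑ i, t i • y i‖ ≤ m * H) (x z : EuclideanSpace ℝ (Fin n)) :
    inner ℝ x (Matrix.toEuclideanCLM (𝕜 := ℝ) (sampleMatrix fun i => t i • μ + y i) z)
      - inner ℝ x μ * inner ℝ μ z ≤ (2 * H * ‖μ‖ + B) * (‖x‖ * ‖z‖) := by
  have hm' : (0 : ℝ) < m := Nat.cast_pos.2 hm
  set w := ∑ i, t i • y i with hw
  have hsum : (m : ℝ)⁻¹ * ∑ i, inner ℝ x (t i • μ + y i) * inner ℝ (t i • μ + y i) z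
      - inner ℝ x μ * inner ℝ μ z
      = (m : ℝ)⁻¹ * (inner ℝ x μ * inner ℝ w z + inner ℝ x w * inner ℝ μ z)
        + (m : ℝ)⁻¹ * ∑ i, inner ℝ x (y i) * inner ℝ (y i) z := by
    have e : ∀ i, inner ℝ x (t i • μ + y i) * inner ℝ (t i • μ + y i) z
        = inner ℝ x μ * inner ℝ μ z + (inner ℝ x μ * inner ℝ (t i • y i) z
          + inner ℝ x (t i • y i) * inner ℝ μ z) + inner ℝ x (y i) * inner ℝ (y i) z := by
      intro i
      simp only [inner_add_left, inner_add_right, real_inner_smul_left, real_inner_smul_right]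
      linear_combination (inner ℝ x μ * inner ℝ μ z) * ht i
    simp only [e]
    have e₁ : ∑ i, inner ℝ x μ * inner ℝ (t i • y i) z = inner ℝ x μ * inner ℝ w z := by
      rw [hw, sum_inner, Finset.mul_sum]
    have e₂ : ∑ i, inner ℝ x (t i • y i) * inner ℝ μ z = inner ℝ x w * inner ℝ μ z := by
      rw [hw, inner_sum, Finset.sum_mul]
    rw [Finset.sum_add_distrib, Finset.sum_add_distrib, Finset.sum_add_distrib, e₁, e₂,
      Finset.sum_const, Finset.card_univ, Fintype.card_fin, nsmul_eq_mul]
    field_simp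
    ring
  rw [inner_toEuclideanCLM_sampleMatrix, hsum]
  have h1 : (m : ℝ)⁻¹ * (inner ℝ x μ * inner ℝ w z + inner ℝ x w * inner ℝ μ z)
      ≤ 2 * H * ‖μ‖ * (‖x‖ * ‖z‖) := by
    rw [inv_mul_le_iff₀ hm']
    have a1 : inner ℝ x μ * inner ℝ w z ≤ (‖x‖ * ‖μ‖) * (‖w‖ * ‖z‖) :=
      (le_abs_self _).trans (by
        rw [abs_mul]
        exact mul_le_mul (abs_real_inner_le_norm _ _) (abs_real_inner_le_norm _ _)
          (abs_nonneg _) (by positivity))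
    have a2 : inner ℝ x w * inner ℝ μ z ≤ (‖x‖ * ‖w‖) * (‖μ‖ * ‖z‖) :=
      (le_abs_self _).trans (by
        rw [abs_mul]
        exact mul_le_mul (abs_real_inner_le_norm _ _) (abs_real_inner_le_norm _ _)
          (abs_nonneg _) (by positivity))
    have a3 := mul_le_mul_of_nonneg_right hH
      (by positivity : 0 ≤ ‖x‖ * ‖μ‖ * ‖z‖)
    nlinarith
  have h2 : (m : ℝ)⁻¹ * ∑ i, inner ℝ x (y i) * inner ℝ (y i) z ≤ B * (‖x‖ * ‖z‖) := by
    have hsq : ∀ x : EuclideanSpace ℝ (Fin n),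
        Real.sqrt (∑ i, inner ℝ x (y i) ^ 2) ≤ Real.sqrt (m * B) * ‖x‖ := by
      intro x
      rw [← Real.sqrt_sq (norm_nonneg x), ← Real.sqrt_mul' _ (sq_nonneg _)]
      apply Real.sqrt_le_sqrt
      have := hq x
      rw [inv_mul_le_iff₀ hm'] at this
      linarith
    have hcs := Real.sum_mul_le_sqrt_mul_sqrt Finset.univ (fun i => inner ℝ x (y i))
      (fun i => inner ℝ z (y i))
    have e : ∑ i, inner ℝ x (y i) * inner ℝ (y i) z = ∑ i, inner ℝ x (y i) * inner ℝ z (y i) :=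
      Finset.sum_congr rfl fun i _ => by rw [real_inner_comm (y i) z]
    rw [inv_mul_le_iff₀ hm', e]
    refine hcs.trans ((mul_le_mul (hsq x) (hsq z) (Real.sqrt_nonneg _) (by positivity)).trans_eq ?_)
    rw [mul_mul_mul_comm, Real.mul_self_sqrt (by positivity)]
    ring
  linarith

theorem noise_lt_of_inner_neg {μ V e : EuclideanSpace ℝ (Fin n)} (hμ : μ ≠ 0) {δ α R : ℝ}
    (hV : ‖V - ‖μ‖⁻¹ • μ‖ ≤ δ) (hδ0 : 0 ≤ δ) (he : ‖e‖ ≤ R) (hδ : δ * (R + ‖μ‖) ≤ α * ‖μ‖)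
    (hneg : inner ℝ V (μ + e) < 0) : inner ℝ μ e < -((1 - α) * ‖μ‖ ^ 2) := by
  have hμ0 : 0 < ‖μ‖ := norm_pos_iff.2 hμ
  have h1 : inner ℝ (‖μ‖⁻¹ • μ) (μ + e) = ‖μ‖ + ‖μ‖⁻¹ * inner ℝ μ e := by
    rw [real_inner_smul_left, inner_add_right, real_inner_self_eq_norm_sq]
    field_simp
  have h2 : inner ℝ (‖μ‖⁻¹ • μ) (μ + e) ≤ inner ℝ V (μ + e) + δ * (R + ‖μ‖) := by
    have h3 := (abs_le.1 (abs_real_inner_le_norm (V - ‖μ‖⁻¹ • μ) (μ + e))).1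
    rw [inner_sub_left] at h3
    have h4 : ‖V - ‖μ‖⁻¹ • μ‖ * ‖μ + e‖ ≤ δ * (R + ‖μ‖) :=
      mul_le_mul hV ((norm_add_le _ _).trans (by linarith)) (norm_nonneg _) hδ0
    linarith
  have h5 : ‖μ‖⁻¹ * inner ℝ μ e < -((1 - α) * ‖μ‖) := by linarith
  rw [inv_mul_lt_iff₀ hμ0] at h5
  linarith

end SampleForms

/-! ### Conditioning on a label and the tail of the noise form -/

namespace IsMixtureSample

variable {n m : ℕ} {Ω : Type*} [MeasurableSpace Ω] {P : Measure Ω}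
  {S : ℤˣ → Matrix (Fin n) (Fin n) ℝ} {θ : Fin m → Ω → ℤˣ}
  {g : Fin m → ℤˣ → Ω → EuclideanSpace ℝ (Fin n)}

/-- A law only makes the noise almost everywhere measurable, whereas evaluating it at a random label
and applying Fubini is done with measurable versions. -/
theorem exists_measurable (h : IsMixtureSample P S θ g) :
    ∃ g' : Fin m → ℤˣ → Ω → EuclideanSpace ℝ (Fin n), IsMixtureSample P S θ g' ∧
      (∀ i k, Measurable (g' i k)) ∧ ∀ i k, g i k =ᵐ[P] g' i k := by
  have hae : ∀ i k, g i k =ᵐ[P] (h.gaussian i k).aemeasurable.mk := fun i k =>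
    (h.gaussian i k).aemeasurable.ae_eq_mk
  have hpi : ∀ i, (fun ω k => g i k ω)
      =ᵐ[P] fun ω k => (h.gaussian i k).aemeasurable.mk (g i k) ω := by
    intro i
    filter_upwards [ae_all_iff.2 (hae i)] with ω hω
    exact funext hω
  refine ⟨fun i k => (h.gaussian i k).aemeasurable.mk, ⟨h.measurable_label, h.rademacher,
    fun i k => (h.gaussian i k).congr (hae i k).symm,
    fun i => (h.indep_label_noise i).congr (ae_eq_refl _) (hpi i),
    h.indep_draws.congr fun i => ?_⟩, fun i k => (h.gaussian i k).aemeasurable.measurable_mk, hae⟩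
  filter_upwards [hpi i] with ω hω
  rw [hω]

theorem measurableSet_label (h : IsMixtureSample P S θ g) (i : Fin m) (j : ℤˣ) :
    MeasurableSet {ω | θ i ω = j} :=
  h.measurable_label i (measurableSet_singleton j)

/-- Conditioning on an event of probability 1/2 at most doubles a probability. This handles events
that involve the whole sample. -/
theorem cond_real_le (h : IsMixtureSample P S θ g) [IsFiniteMeasure P] (i : Fin m) (j : ℤˣ)
    (B : Set Ω) : (cond P {ω | θ i ω = j}).real B ≤ 2 * P.real B := by
  rw [measureReal_def, cond_apply (h.measurableSet_label i j), h.rademacher i j, one_div, inv_inv,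
    ENNReal.toReal_mul]
  exact mul_le_mul_of_nonneg_left (measureReal_mono Set.inter_subset_right) (by simp)

theorem cond_real_noise (h : IsMixtureSample P S θ g) (i : Fin m) (j : ℤˣ)
    {B : Set (EuclideanSpace ℝ (Fin n))} (hB : MeasurableSet B) :
    (cond P {ω | θ i ω = j}).real {ω | g i j ω ∈ B}
      = (multivariateGaussian 0 (S j)).real B := by
  have hind := (h.indep_label_noise i).measure_inter_preimage_eq_mul {j}
    ((fun f : ℤˣ → EuclideanSpace ℝ (Fin n) => f j) ⁻¹' B) (measurableSet_singleton j)
    (measurable_pi_apply j hB)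
  have hlaw := (h.gaussian i j).measure_eq (p := fun y => y ∈ B) hB
  have h1 : P ({ω | θ i ω = j} ∩ {ω | g i j ω ∈ B})
      = 1 / 2 * (multivariateGaussian 0 (S j)) B := by
    rw [← h.rademacher i j]
    refine hind.trans ?_
    congr 1
  rw [measureReal_def, cond_apply (h.measurableSet_label i j), h1, h.rademacher i j, one_div,
    inv_inv, ← mul_assoc, ENNReal.mul_inv_cancel (by simp) (by simp), one_mul]
  rfl

variable [IsProbabilityMeasure P]

theorem noise_form_tail [Nonempty (Fin n)] (h : IsMixtureSample P S θ g) (hm : 0 < m)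
    (hg : ∀ i k, Measurable (g i k)) (hS : ∀ k, (S k).PosDef) :
    P.real {ω | ∃ x, (lambdaOne (S 1) + lambdaOne (S (-1))) / 2
        * (168 * (Real.sqrt (2 * n / m) + 2 * n / m) + 1) * ‖x‖ ^ 2
      < (m : ℝ)⁻¹ * ∑ i, inner ℝ x (g i (θ i ω) ω) ^ 2} ≤ Real.exp (-n) := by
  have hm' : (0 : ℝ) < m := Nat.cast_pos.2 hm
  have hn : (0 : ℝ) < n := Nat.cast_pos.2 (Fin.pos_iff_nonempty.2 inferInstance)
  obtain ⟨x₀, hx₀⟩ : ∃ x : EuclideanSpace ℝ (Fin n), x ≠ 0 :=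
    ⟨EuclideanSpace.single (Classical.arbitrary _) 1, by simp⟩
  have hl : ∀ k, 0 < lambdaOne (S k) := fun k => lambdaOne_pos (hS k) hx₀
  have hσ : ∀ k x, sqrtNorm (S k) x ^ 2 ≤ lambdaOne (S k) * ‖x‖ ^ 2 := fun k x => by
    rw [sqrtNorm_sq (hS k).posSemidef]
    exact inner_toEuclideanCLM_le_lambdaOne (hS k).isHermitian x
  set L := lambdaOne (S 1) + lambdaOne (S (-1)) with hLdef
  have hL0 : 0 < L := add_pos (hl _) (hl _)
  have hL : ∀ k x, sqrtNorm (S k) x ^ 2 ≤ L * ‖x‖ ^ 2 := fun k x => (hσ k x).trans <| by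
    refine mul_le_mul_of_nonneg_right ?_ (sq_nonneg _)
    rcases Int.units_eq_one_or k with rfl | rfl
    · linarith [hl (-1)]
    · linarith [hl 1]
  obtain ⟨r, hr, hr0, hr2⟩ : ∃ r, r = Real.sqrt (n / m) ∧ 0 < r ∧ (n : ℝ) = m * r ^ 2 := by
    refine ⟨_, rfl, Real.sqrt_pos.2 (by positivity), ?_⟩
    rw [Real.sq_sqrt (by positivity)]
    field_simp
  -- The exponent s = τ/L balances mτ² against n = mr²: τ is of order min(r, 1), stays below the cap
  -- 1/8, and makes 32τ + 10r²/τ at most 84(r + r²). Doubling 84 gives C = 168.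
  obtain ⟨τ, hτ⟩ : ∃ τ, τ = r / (8 * (1 + r)) := ⟨_, rfl⟩
  have hτ0 : 0 < τ := hτ ▸ by positivity
  have hτ1 : τ ≤ 1 / 8 := by rw [hτ, div_le_iff₀ (by positivity)]; linarith
  have hτ2 : τ ≤ r / 8 := by
    rw [hτ]
    exact div_le_div_of_nonneg_left hr0.le (by norm_num) (by linarith)
  have hτ3 : r ^ 2 = 8 * (r + r ^ 2) * τ := by rw [hτ]; field_simp
  have hdev := h.centredForm_deviation hg (fun k => (hS k).posSemidef) hL hL0 (s := τ / L)
    (by positivity) (by rwa [div_mul_cancel₀ _ hL0.ne'])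
  rw [div_mul_cancel₀ _ hL0.ne'] at hdev
  refine (measureReal_mono ?_).trans hdev
  rintro ω ⟨x, hx⟩
  refine ⟨x, ?_⟩
  by_contra! hle
  have hcf : ∑ i, inner ℝ x (g i (θ i ω) ω) ^ 2
      = centredForm S (fun i => g i (θ i ω) ω) x + m * meanForm S x := by
    rw [centredForm, Finset.sum_sub_distrib, Finset.sum_const, Finset.card_univ, Fintype.card_fin,
      nsmul_eq_mul]
    ring
  have hmean : meanForm S x ≤ L / 2 * ‖x‖ ^ 2 := by
    unfold meanForm
    linarith [hσ 1 x, hσ (-1) x]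
  have hc : centredForm S (fun i => g i (θ i ω) ω) x ≤ m * (84 * (r + r ^ 2)) * L * ‖x‖ ^ 2 := by
    refine (le_abs_self _).trans ?_
    rw [div_mul_eq_mul_div, div_le_iff₀ hL0] at hle
    have h1 : 2 * (m * (16 * τ ^ 2) + 5 * n) ≤ τ * (m * (84 * (r + r ^ 2))) := by
      have h2 : 32 * τ * τ ≤ 4 * (r + r ^ 2) * τ :=
        mul_le_mul_of_nonneg_right (by nlinarith) hτ0.le
      have h3 : 32 * τ * τ + 10 * r ^ 2 ≤ 84 * (r + r ^ 2) * τ := by linarith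
      have h4 := mul_le_mul_of_nonneg_left h3 hm'.le
      rw [hr2]
      linarith
    have h5 := mul_le_mul_of_nonneg_right h1 (by positivity : 0 ≤ ‖x‖ ^ 2 * L)
    refine le_of_mul_le_mul_left ?_ hτ0
    linarith
  have hsqrt : r ≤ Real.sqrt (2 * n / m) := by
    rw [hr]
    apply Real.sqrt_le_sqrt
    rw [mul_div_assoc]
    linarith [(by positivity : 0 ≤ (n : ℝ) / m)]
  have hr2' : r ^ 2 ≤ 2 * n / m := by
    rw [le_div_iff₀ hm', hr2]
    nlinarith [mul_pos hm' (pow_pos hr0 2)]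
  rw [hcf, lt_inv_mul_iff₀ hm'] at hx
  have h6 : L / 2 * (168 * (r + r ^ 2) + 1) * ‖x‖ ^ 2
      ≤ L / 2 * (168 * (Real.sqrt (2 * n / m) + 2 * n / m) + 1) * ‖x‖ ^ 2 := by
    gcongr
  have h7 := mul_le_mul_of_nonneg_left h6 hm'.le
  have h8 := mul_le_mul_of_nonneg_left hmean hm'.le
  linarith

end IsMixtureSample

/-! ### Closeness of the sample eigenvector to the direction of μ -/

section TopEigenvector

variable {n m : ℕ}

theorem isSymmetric_toEuclideanCLM {A : Matrix (Fin n) (Fin n) ℝ} (hA : A.IsHermitian) :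
    (Matrix.toEuclideanCLM (𝕜 := ℝ) A : EuclideanSpace ℝ (Fin n) →ₗ[ℝ] _).IsSymmetric :=
  ContinuousLinearMap.isSelfAdjoint_iff_isSymmetric.1
    (hA.isSelfAdjoint.map (Matrix.toEuclideanCLM (𝕜 := ℝ)))

theorem two_rpow_five_halves : (2 : ℝ) ^ (5 / 2 : ℝ) = 4 * Real.sqrt 2 := by
  rw [show (5 / 2 : ℝ) = 2 + 1 / 2 by norm_num, Real.rpow_add (by norm_num), ← Real.sqrt_eq_rpow]
  norm_num

/-- This exhibits δ as √2 times the Davis–Kahan bound 2(2H‖μ‖ + B)/‖μ‖². The factor √2 is the price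
of passing from the sine of the angle to the distance of unit vectors. -/
theorem delta_eq {c C K : ℝ} {μ : EuclideanSpace ℝ (Fin n)} (S : ℤˣ → Matrix (Fin n) (Fin n) ℝ)
    (hμ : μ ≠ 0) :
    delta c C K m μ S = Real.sqrt 2 * (2 * (2 * (cOne c * Real.sqrt (n * maxLambda S / m)) * ‖μ‖
      + (lambdaOne (S 1) + lambdaOne (S (-1))) / 2
        * (C * K ^ 2 * (Real.sqrt (2 * n / m) + 2 * n / m) + 1)) / ‖μ‖ ^ 2) := by
  have hμ0 : 0 < ‖μ‖ := norm_pos_iff.2 hμ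
  rw [delta, two_rpow_five_halves, ← div_div (_ * _ : ℝ), Real.sqrt_div' _ (sq_nonneg _),
    Real.sqrt_sq hμ0.le]
  field_simp
  ring

/-- Both V and w are compared with u; w serves only to fix the sign of V. The condition δ < 1 says
D² < 1/2, which is the 45° requirement of `inner_nonneg_of_inner_pos`. -/
theorem norm_topEigenvector_sub_le {c C K : ℝ} {μ w V : EuclideanSpace ℝ (Fin n)}
    {S : ℤˣ → Matrix (Fin n) (Fin n) ℝ} {t : Fin m → ℝ} {y : Fin m → EuclideanSpace ℝ (Fin n)}
    (hμ : μ ≠ 0) (hS : ∀ k, (S k).PosDef) (hm : 0 < m) (hC : 0 ≤ C) (ht : ∀ i, t i ^ 2 = 1)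
    (hδ : delta c C K m μ S < 1)
    (hw : IsTopEigenvector (populationMatrix μ S) w) (hwμ : 0 < inner ℝ w μ)
    (hV : IsTopEigenvector (sampleMatrix fun i => t i • μ + y i) V) (hVw : 0 < inner ℝ V w)
    (hH : ‖∑ i, t i • y i‖ ≤ cOne c * Real.sqrt (n * (m * maxLambda S)))
    (hq : ∀ x, (m : ℝ)⁻¹ * ∑ i, inner ℝ x (y i) ^ 2
      ≤ (lambdaOne (S 1) + lambdaOne (S (-1))) / 2
        * (C * K ^ 2 * (Real.sqrt (2 * n / m) + 2 * n / m) + 1) * ‖x‖ ^ 2) :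
    ‖V - ‖μ‖⁻¹ • μ‖ ≤ delta c C K m μ S := by
  have hm' : (0 : ℝ) < m := Nat.cast_pos.2 hm
  have hμ0 : 0 < ‖μ‖ := norm_pos_iff.2 hμ
  have hl : ∀ k, 0 < lambdaOne (S k) := fun k => lambdaOne_pos (hS k) hμ
  have hc1 : 0 ≤ cOne c := zero_le_one.trans (one_le_cOne c)
  set L := lambdaOne (S 1) + lambdaOne (S (-1)) with hLdef
  have hL0 : 0 < L := add_pos (hl _) (hl _)
  set H := cOne c * Real.sqrt (n * maxLambda S / m) with hHdef
  have hH0 : 0 ≤ H := mul_nonneg hc1 (Real.sqrt_nonneg _)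
  set B := L / 2 * (C * K ^ 2 * (Real.sqrt (2 * n / m) + 2 * n / m) + 1)
  have hB : L / 2 ≤ B := by
    refine le_mul_of_one_le_right (by positivity) ?_
    have : 0 ≤ C * K ^ 2 * (Real.sqrt (2 * n / m) + 2 * n / m) := by positivity
    linarith
  have hB0 : 0 ≤ B := by linarith
  have hH' : ‖∑ i, t i • y i‖ ≤ m * H := by
    refine hH.trans_eq ?_
    have e : (n : ℝ) * (m * maxLambda S) = m ^ 2 * (n * maxLambda S / m) := by field_simp
    rw [e, Real.sqrt_mul (sq_nonneg _), Real.sqrt_sq hm'.le, hHdef]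
    ring
  set u := ‖μ‖⁻¹ • μ with hudef
  have hu : ‖u‖ = 1 := by
    rw [hudef, norm_smul, norm_inv, norm_norm, inv_mul_cancel₀ hμ0.ne']
  have hμu : μ = ‖μ‖ • u := by rw [hudef, smul_smul, mul_inv_cancel₀ hμ0.ne', one_smul]
  obtain ⟨D, hD⟩ : ∃ D, D = 2 * (2 * H * ‖μ‖ + B) / ‖μ‖ ^ 2 := ⟨_, rfl⟩
  have hδD : delta c C K m μ S = Real.sqrt 2 * D := by rw [hD]; exact delta_eq S hμ
  have hD0 : 0 ≤ D := hD ▸ by positivity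
  have hD2 : D ^ 2 < 1 / 2 := by
    rw [hδD] at hδ
    have h1 : (Real.sqrt 2 * D) ^ 2 < 1 := by
      rw [sq_lt_one_iff_abs_lt_one, abs_of_nonneg (by positivity)]
      exact hδ
    rw [mul_pow, Real.sq_sqrt (by norm_num)] at h1
    linarith
  have hVu : 1 - inner ℝ V u ^ 2 ≤ D ^ 2 := by
    rw [hD]
    exact one_sub_inner_sq_le (isSymmetric_toEuclideanCLM (isHermitian_sampleMatrix _)) hu hV.1 hμ
      hμu (hV.inner_le_inner (isHermitian_sampleMatrix _) hu) (by positivity)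
      (inner_sampleMatrix_sub_le ht hm hB0 hq hH')
  have hherm := isHermitian_populationMatrix μ fun k => (hS k).isHermitian
  have hwu : 1 - inner ℝ w u ^ 2 ≤ D ^ 2 := by
    refine (one_sub_inner_sq_le (B := L / 2) (isSymmetric_toEuclideanCLM hherm) hu hw.1 hμ hμu
      (hw.inner_le_inner hherm hu) (by positivity) fun x z => ?_).trans ?_
    · rw [inner_toEuclideanCLM_populationMatrix]
      have h1 := inner_toEuclideanCLM_le_mul_norm (hS 1).posSemidef (hl 1).le x z
      have h2 := inner_toEuclideanCLM_le_mul_norm (hS (-1)).posSemidef (hl (-1)).le x z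
      rw [hLdef]
      linarith
    · refine pow_le_pow_left₀ (by positivity) ?_ 2
      rw [hD]
      refine div_le_div_of_nonneg_right ?_ (sq_nonneg _)
      have : 0 ≤ 2 * H * ‖μ‖ := by positivity
      linarith
  have hwu0 : 0 < inner ℝ w u := by
    rw [hudef, real_inner_smul_right]
    exact mul_pos (inv_pos.2 hμ0) hwμ
  have hpos := inner_nonneg_of_inner_pos hu hV.1 hw.1 hVw hwu0 (by linarith) (by linarith)
  rw [hδD]
  exact norm_sub_le_of_inner_nonneg hu hV.1 hpos hD0 hVu

end TopEigenvector

/-! ### Size of the separation and the misclassification bound -/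

theorem sq_separation_ge {n : ℕ} {μ : EuclideanSpace ℝ (Fin n)} (hμ : μ ≠ 0)
    {S : ℤˣ → Matrix (Fin n) (Fin n) ℝ} (hS : ∀ k, (S k).PosDef) :
    0 < separation μ S ∧
      ‖μ‖ ^ 2 ≤ (lambdaOne (S 1) + lambdaOne (S (-1))) * separation μ S ^ 2 := by
  have hμ0 : 0 < ‖μ‖ := norm_pos_iff.2 hμ
  have hl : ∀ k, 0 < lambdaOne (S k) := fun k => lambdaOne_pos (hS k) hμ
  have hσ : ∀ k, 0 < sqrtNorm (S k) μ ^ 2 ∧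
      sqrtNorm (S k) μ ^ 2 ≤ (lambdaOne (S 1) + lambdaOne (S (-1))) * ‖μ‖ ^ 2 := fun k => by
    rw [sqrtNorm_sq (hS k).posSemidef]
    refine ⟨inner_toEuclideanCLM_pos (hS k) hμ,
      (inner_toEuclideanCLM_le_lambdaOne (hS k).isHermitian μ).trans ?_⟩
    refine mul_le_mul_of_nonneg_right ?_ (sq_nonneg _)
    rcases Int.units_eq_one_or k with rfl | rfl
    · linarith [hl (-1)]
    · linarith [hl 1]
  have hmax : ∃ k, max (sqrtNorm (S (-1)) μ) (sqrtNorm (S 1) μ) = sqrtNorm (S k) μ := by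
    rcases max_choice (sqrtNorm (S (-1)) μ) (sqrtNorm (S 1) μ) with h | h
    · exact ⟨-1, h⟩
    · exact ⟨1, h⟩
  obtain ⟨k, hk⟩ := hmax
  have h0 : 0 < sqrtNorm (S k) μ := lt_of_le_of_ne (norm_nonneg _)
    fun h => by have := (hσ k).1; rw [← h] at this; norm_num at this
  rw [separation, hk]
  refine ⟨by positivity, ?_⟩
  rw [div_pow, ← mul_div_assoc, le_div_iff₀ (by positivity)]
  nlinarith [mul_le_mul_of_nonneg_left (hσ k).2 (sq_nonneg ‖μ‖)]

theorem div_sqrtNorm_ge {n : ℕ} {μ : EuclideanSpace ℝ (Fin n)} {S : ℤˣ → Matrix (Fin n) (Fin n) ℝ}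
    {j : ℤˣ} (hj : 0 < sqrtNorm (S j) μ) : separation μ S ≤ ‖μ‖ ^ 2 / sqrtNorm (S j) μ := by
  refine div_le_div_of_nonneg_left (sq_nonneg _) hj ?_
  rcases Int.units_eq_one_or j with rfl | rfl
  · exact le_max_right _ _
  · exact le_max_left _ _

/-- The upper bound for the conditional misclassification probability. -/
theorem IsMixtureSample.cond_misclassified_le {n m : ℕ} {Ω : Type*} [MeasurableSpace Ω]
    {P : Measure Ω} [IsProbabilityMeasure P] {S : ℤˣ → Matrix (Fin n) (Fin n) ℝ}
    {θ : Fin m → Ω → ℤˣ} {g : Fin m → ℤˣ → Ω → EuclideanSpace ℝ (Fin n)}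
    (h : IsMixtureSample P S θ g) {c : ℝ} (hc : 0 < c) (hconc : IsNormConcentrationConstant c)
    {μ w : EuclideanSpace ℝ (Fin n)} {V : Ω → EuclideanSpace ℝ (Fin n)} (hμ : μ ≠ 0)
    (hS : ∀ k, (S k).PosDef) (hw : IsTopEigenvector (populationMatrix μ S) w)
    (hwμ : 0 < inner ℝ w μ)
    (hV : ∀ᵐ ω ∂P, IsTopEigenvector
      (sampleMatrix (fun i => observation μ (θ i) (g i) ω)) (V ω) ∧ 0 < inner ℝ (V ω) w)
    {α : ℝ} (hα1 : α < 1)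
    (hδ : delta c 168 1 m μ S ≤ α * ‖μ‖ / (cOne c * Real.sqrt (n * maxLambda S) + ‖μ‖))
    (i : Fin m) (j : ℤˣ) :
    (cond P {ω | θ i ω = j}).real
        {ω | ((j : ℤ) : ℝ) * inner ℝ (V ω) (observation μ (θ i) (g i) ω) < 0}
      ≤ cdf (gaussianReal 0 1) (-((1 - α) * separation μ S)) + 10 * Real.exp (-(n : ℝ)) := by
  have hμ0 : 0 < ‖μ‖ := norm_pos_iff.2 hμ
  have hm : 0 < m := i.pos
  have : Nonempty (Fin n) := by
    by_contra hempty
    rw [not_nonempty_iff] at hempty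
    exact hμ (Subsingleton.elim _ _)
  have hl : ∀ k, 0 < lambdaOne (S k) := fun k => lambdaOne_pos (hS k) hμ
  have hmaxL : ∀ k x, inner ℝ x (Matrix.toEuclideanCLM (𝕜 := ℝ) (S k) x)
      ≤ maxLambda S * ‖x‖ ^ 2 := fun k x => by
    refine (inner_toEuclideanCLM_le_lambdaOne (hS k).isHermitian x).trans
      (mul_le_mul_of_nonneg_right ?_ (sq_nonneg _))
    rcases Int.units_eq_one_or k with rfl | rfl
    · exact le_max_right _ _
    · exact le_max_left _ _
  set R := cOne c * Real.sqrt (n * maxLambda S)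
  have hR : 0 ≤ R := mul_nonneg (zero_le_one.trans (one_le_cOne c)) (Real.sqrt_nonneg _)
  have hδ1 : delta c 168 1 m μ S < 1 := by
    refine hδ.trans_lt ?_
    rw [div_lt_one (by positivity)]
    nlinarith
  have hδR : delta c 168 1 m μ S * (R + ‖μ‖) ≤ α * ‖μ‖ := (le_div_iff₀ (by positivity)).1 hδ
  obtain ⟨g', h', hg', hgg'⟩ := h.exists_measurable
  have hsign : ∀ k : ℤˣ, ((k : ℤ) : ℝ) ^ 2 = 1 := fun k => by
    rcases Int.units_eq_one_or k with rfl | rfl <;> norm_num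
  have habs : ∀ k : ℤˣ, |((k : ℤ) : ℝ)| = 1 := fun k => by
    rcases Int.units_eq_one_or k with rfl | rfl <;> norm_num
  set Q := cond P {ω | θ i ω = j}
  have hQ : IsProbabilityMeasure Q := cond_isProbabilityMeasure (by rw [h.rademacher]; simp)
  have hσ0 : 0 < sqrtNorm (S j) μ := by
    refine lt_of_le_of_ne (norm_nonneg _) fun h0 => ?_
    have h1 := inner_toEuclideanCLM_pos (hS j) hμ
    rw [← sqrtNorm_sq (hS j).posSemidef, ← h0] at h1
    norm_num at h1
  set Elin := {ω | g' i j ω ∈ {y | inner ℝ (((j : ℤ) : ℝ) • μ) y < -((1 - α) * ‖μ‖ ^ 2)}}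
  set Enorm := {ω | g' i j ω ∈ {y | R < ‖y‖}}
  set Emean := {ω | cOne c * Real.sqrt (n * (m * maxLambda S))
    < ‖∑ i, ((θ i ω : ℤ) : ℝ) • g' i (θ i ω) ω‖}
  set Eform := {ω | ∃ x, (lambdaOne (S 1) + lambdaOne (S (-1))) / 2
      * (168 * (Real.sqrt (2 * n / m) + 2 * n / m) + 1) * ‖x‖ ^ 2
    < (m : ℝ)⁻¹ * ∑ i, inner ℝ x (g' i (θ i ω) ω) ^ 2}
  have hlin : Q.real Elin ≤ cdf (gaussianReal 0 1) (-((1 - α) * separation μ S)) := by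
    rw [h'.cond_real_noise i j (measurableSet_lt (by fun_prop) measurable_const)]
    have hsn : sqrtNorm (S j) (((j : ℤ) : ℝ) • μ) = sqrtNorm (S j) μ := by
      rw [sqrtNorm, map_smul, norm_smul, Real.norm_eq_abs,
        habs j, one_mul, sqrtNorm]
    refine (multivariateGaussian_inner_lt (hS j).posSemidef (by rw [hsn]; exact hσ0) _).trans
      (monotone_cdf _ ?_)
    rw [hsn, mul_div_assoc]
    exact neg_le_neg (mul_le_mul_of_nonneg_left (div_sqrtNorm_ge hσ0) (by linarith))
  have hnorm : Q.real Enorm ≤ 2 * Real.exp (-n) := by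
    rw [h'.cond_real_noise i j (measurableSet_lt measurable_const measurable_norm)]
    exact multivariateGaussian_norm_tail hc hconc (hS j).posSemidef (hmaxL j)
  -- `Emean` and `Eform` depend on all the draws, so their probabilities double under conditioning.
  -- The exceptional events total 2 + 4 + 2 = 8 times e⁻ⁿ, within the allowed 10.
  have hmean : Q.real Emean ≤ 2 * (2 * Real.exp (-n)) :=
    (h'.cond_real_le i j _).trans (mul_le_mul_of_nonneg_left
      (h'.mean_noise_tail hg' (fun k => (hS k).posSemidef) hmaxL hc hconc) (by norm_num))
  have hform : Q.real Eform ≤ 2 * Real.exp (-n) :=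
    (h'.cond_real_le i j _).trans (mul_le_mul_of_nonneg_left
      (h'.noise_form_tail hm hg' hS) (by norm_num))
  have hQP : Q ≪ P := cond_absolutelyContinuous
  have hlabel : ∀ᵐ ω ∂Q, θ i ω = j := ae_cond_mem (h.measurableSet_label i j)
  -- The inclusion is pathwise, so the dependence of V on the classified observation plays no role.
  have hsub : {ω | ((j : ℤ) : ℝ) * inner ℝ (V ω) (observation μ (θ i) (g i) ω) < 0}
      ≤ᵐ[Q] (Elin ∪ Enorm ∪ Emean ∪ Eform : Set Ω) := by
    have hgall : ∀ᵐ ω ∂P, ∀ i k, g i k ω = g' i k ω :=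
      ae_all_iff.2 fun i => ae_all_iff.2 fun k => hgg' i k
    filter_upwards [hlabel, hQP.ae_le hgall, hQP.ae_le hV] with ω hω hgω hVω hneg
    by_contra hnot
    have hnot' : ω ∉ Elin ∪ Enorm ∪ Emean ∪ Eform := hnot
    simp only [Set.mem_union, not_or] at hnot'
    obtain ⟨⟨⟨h1, h2⟩, h3⟩, h4⟩ := hnot'
    change _ < _ at hneg
    apply h1
    have hobs : (fun i => observation μ (θ i) (g i) ω)
        = fun i => ((θ i ω : ℤ) : ℝ) • μ + g' i (θ i ω) ω := by
      funext i
      rw [observation, hgω]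
    rw [hobs] at hVω
    have hclose := norm_topEigenvector_sub_le (c := c) (C := 168) (K := 1) hμ hS hm (by norm_num)
      (fun i => hsign (θ i ω)) hδ1 hw hwμ hVω.1 hVω.2 (not_lt.1 h3) fun x => by
        rw [one_pow, mul_one]
        exact not_lt.1 fun hx => h4 ⟨x, hx⟩
    have hneg' : inner ℝ (V ω) (μ + ((j : ℤ) : ℝ) • g' i j ω) < 0 := by
      rw [observation, hω, hgω, ← real_inner_smul_right, smul_add, smul_smul, ← sq, hsign,
        one_smul] at hneg
      exact hneg
    have hnormj : ‖((j : ℤ) : ℝ) • g' i j ω‖ ≤ R := by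
      rw [norm_smul, Real.norm_eq_abs, habs j, one_mul]
      exact not_lt.1 h2
    have := noise_lt_of_inner_neg hμ hclose ((norm_nonneg _).trans hclose) hnormj hδR hneg'
    rw [real_inner_smul_right] at this
    show inner ℝ (((j : ℤ) : ℝ) • μ) (g' i j ω) < _
    rwa [real_inner_smul_left]
  calc Q.real _ ≤ Q.real (Elin ∪ Enorm ∪ Emean ∪ Eform) :=
        ENNReal.toReal_mono (measure_ne_top _ _) (measure_mono_ae hsub)
    _ ≤ Q.real Elin + Q.real Enorm + Q.real Emean + Q.real Eform := by
        refine (measureReal_union_le _ _).trans (add_le_add_left ?_ _)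
        refine (measureReal_union_le _ _).trans (add_le_add_left ?_ _)
        exact measureReal_union_le _ _
    _ ≤ _ := by
        have := Real.exp_pos (-(n : ℝ))
        linarith

end SpectralClustering

/-! ### The main theorem -/

theorem theorem1 :
    (∃ c : ℝ, 0 < c ∧ SpectralClustering.IsNormConcentrationConstant c) ∧
    ∃ C K : ℝ, 0 < C ∧ 0 < K ∧
      ∀ c : ℝ, 0 < c → SpectralClustering.IsNormConcentrationConstant c →
      ∀ (n m : ℕ) (μ : EuclideanSpace ℝ (Fin n)) (S : ℤˣ → Matrix (Fin n) (Fin n) ℝ),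
        μ ≠ 0 → (∀ k, (S k).PosDef) →
      ∀ (Ω : Type*) [MeasurableSpace Ω] (P : MeasureTheory.Measure Ω)
        [MeasureTheory.IsProbabilityMeasure P]
        (θ : Fin m → Ω → ℤˣ) (g : Fin m → ℤˣ → Ω → EuclideanSpace ℝ (Fin n)),
        SpectralClustering.IsMixtureSample P S θ g →
      ∀ (w : EuclideanSpace ℝ (Fin n)) (V : Ω → EuclideanSpace ℝ (Fin n)),
        -- `w` is `γ₁(Σ)`, with its sign fixed by the class `θ = 1`
        SpectralClustering.IsTopEigenvector (SpectralClustering.populationMatrix μ S) w →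
        0 < inner ℝ w μ →
        -- `V` is `γ₁(Sₘ)`, with the sign convention `⟨γ₁(Sₘ), γ₁(Σ)⟩ > 0`
        (∀ᵐ ω ∂P,
          SpectralClustering.IsTopEigenvector
            (SpectralClustering.sampleMatrix
              (fun i => SpectralClustering.observation μ (θ i) (g i) ω)) (V ω) ∧
          0 < inner ℝ (V ω) w) →
      ∀ α : ℝ, 0 < α → α < 1 →
        SpectralClustering.delta c C K m μ S ≤
          α * ‖μ‖ / (SpectralClustering.cOne c
            * Real.sqrt (n * SpectralClustering.maxLambda S) + ‖μ‖) →
      ∀ (i : Fin m) (j : ℤˣ),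
        |(ProbabilityTheory.cond P {ω | θ i ω = j}).real
            {ω | ((j : ℤ) : ℝ)
              * inner ℝ (V ω) (SpectralClustering.observation μ (θ i) (g i) ω) < 0}
          - ProbabilityTheory.cdf (ProbabilityTheory.gaussianReal 0 1)
              (-SpectralClustering.separation μ S)|
        ≤ α * SpectralClustering.separation μ S
            * ProbabilityTheory.gaussianPDFReal 0 1
                ((1 - α) * SpectralClustering.separation μ S)
          + 10 * Real.exp (-(n : ℝ)) := by
  refine ⟨SpectralClustering.exists_isNormConcentrationConstant, 168, 1, by norm_num, one_pos, ?_⟩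
  intro c hc hconc n m μ S hμ hS Ω _ P _ θ g h w V hw hwμ hV α hα hα1 hδ i j
  have hμ0 : 0 < ‖μ‖ := norm_pos_iff.2 hμ
  obtain ⟨hA, hA2⟩ := SpectralClustering.sq_separation_ge hμ hS
  -- Only the final +1 in the second summand of δ is needed: it gives L/‖μ‖² ≤ δ, and δ ≤ α because
  -- ‖μ‖/(c₁√(nλ) + ‖μ‖) ≤ 1.
  have hαA : 1 ≤ α * SpectralClustering.separation μ S ^ 2 := by
    set L := SpectralClustering.lambdaOne (S 1) + SpectralClustering.lambdaOne (S (-1)) with hL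
    have hL0 : 0 < L := add_pos (SpectralClustering.lambdaOne_pos (hS 1) hμ)
      (SpectralClustering.lambdaOne_pos (hS (-1)) hμ)
    have hc1 := SpectralClustering.one_le_cOne c
    have h1 : L / ‖μ‖ ^ 2 ≤ SpectralClustering.delta c 168 1 m μ S := by
      rw [SpectralClustering.delta, ← hL]
      have h2 : 1 ≤ Real.sqrt 2 := Real.one_le_sqrt.2 (by norm_num)
      have h3 : (1 : ℝ) ≤ 168 * 1 ^ 2 * (Real.sqrt (2 * n / m) + 2 * n / m) + 1 := by
        have : 0 ≤ 168 * 1 ^ 2 * (Real.sqrt (2 * n / m) + 2 * n / m) := by positivity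
        linarith
      have h4 : L / ‖μ‖ ^ 2 ≤ Real.sqrt 2 * (L / ‖μ‖ ^ 2)
          * (168 * 1 ^ 2 * (Real.sqrt (2 * n / m) + 2 * n / m) + 1) :=
        (le_mul_of_one_le_left (by positivity) h2).trans
          (le_mul_of_one_le_right (by positivity) h3)
      refine h4.trans (le_add_of_nonneg_left ?_)
      positivity
    have h5 : L / ‖μ‖ ^ 2 ≤ α := by
      refine (h1.trans hδ).trans ?_
      have h6 : 0 ≤ SpectralClustering.cOne c
          * Real.sqrt (n * SpectralClustering.maxLambda S) :=
        mul_nonneg (by linarith) (Real.sqrt_nonneg _)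
      rw [div_le_iff₀ (by positivity)]
      nlinarith
    rw [div_le_iff₀ (by positivity)] at h5
    have h7 : L * 1 ≤ L * (α * SpectralClustering.separation μ S ^ 2) := by
      nlinarith [mul_le_mul_of_nonneg_left hA2 hα.le]
    exact le_of_mul_le_mul_left h7 hL0
  exact SpectralClustering.abs_sub_cdf_le MeasureTheory.measureReal_nonneg (by positivity) hA hα hα1
    hαA (h.cond_misclassified_le hc hconc hμ hS hw hwμ hV hα1 hδ i j)
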